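/- Let $n\ge1$ and $k_1,k_2\ge0$ be integers. Identify the Heisenberg group $\mathbb{H}^n$ with $\mathbb{R}^{2n}\times\mathbb{R}$, with elements $(x,t)$, and let $$p_s(x,t)=\frac{1}{(4\pi)^n(2\pi)s^{n+1}}\int_{\mathbb{R}}e^{\frac{i}{s}\lambda t-\frac{|x|^2}{4s}|\lambda|\coth|\lambda|}\left(\frac{|\lambda|}{\sinh|\lambda|}\right)^n\,\mathrm{d}\lambda\qquad(s>0)$$ be its heat kernel. It is a smooth function of $R=|x|^2/4\in[0,\infty)$ and $|t|\in[0,\infty)$; put $$p_{1,k_1,k_2}(x,t)=\frac{\partial^{k_1}}{\partial R^{k_1}}\frac{\partial^{k_2}}{\partial|t|^{k_2}}p_1(x,t).$$ Let $\delta=\sqrt{\frac{R}{\pi|t|}}$ (for $t\neq0$) and $\kappa=2\sqrt{\pi|t|R}$. Let $\theta(y)=\frac{2y-\sin(2y)}{2\sin^2y}$ for $0<|y|<\pi$ and $\theta(0)=0$, so that $\theta$ is a bijection of $(-\pi,\pi)$ onto $\mathbb{R}$, and let $d(x,t)$ be the Carnot-Carathéodory distance of $(x,t)$ from the origin, that is,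 $d(x,t)=|x|\frac{y}{\sin y}$ with $y=\theta^{-1}(|t|/R)$ if $x\ne0$ and $t\ne0$, $d(x,0)=|x|$, and $d(0,t)=\sqrt{4\pi|t|}$. Finally let $I_\nu(z)=\sum_{k\ge0}\frac{z^{2k+\nu}}{2^{2k+\nu}\,k!\,\Gamma(k+\nu+1)}$ be the modified Bessel function. 1. Fix $C>1$. If $\delta\to0^+$ while $1/C\le\kappa\le C$, then $$p_{1,k_1,k_2}(x,t)=\frac{(-1)^{k_2}\pi^{k_1+k_2}}{4^n(\pi\delta)^{n+k_1-1}}\,e^{-\frac14d(x,t)^2}e^{-\kappa}I_{n+k_1-1}(\kappa)\,[1+O(\delta)].$$ That is, there are $\delta_0>0$ and $K$, depending only on $n,k_1,k_2,C$, such that for all $(x,t)$ with $\delta\le\delta_0$ and $1/C\le\kappa\le C$ the equality holds with a term $O(\delta)$ of modulus at most $K\delta$. 2. If $\kappa\to0^+$ and $|t|\to\infty$, then $$p_{1,k_1,k_2}(x,t)=\frac{(-1)^{k_2}\pi^{k_1+k_2}}{4^n(n+k_1-1)!}\,|t|^{n+k_1-1}e^{-\frac14d(x,t)^2}\left[1+O\left(\frac1{|t|}+\kappa\right)\right].$$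 That is, there are $\kappa_0>0$, $T>0$ and $K$, depending only on $n,k_1,k_2$, such that for all $(x,t)$ with $0\le\kappa\le\kappa_0$ and $|t|\ge T$ (points with $x=0$ included) the equality holds with a term $O\left(\frac1{|t|}+\kappa\right)$ of modulus at most $K\left(\frac1{|t|}+\kappa\right)$. -/

import Mathlib

open Set

noncomputable section

namespace Heisenberg

/-- The heat kernel `p_s(x,t)` of the Heisenberg group `ℍⁿ`, realized on `ℝ²ⁿ × ℝ` through the
exponential map (with sub-Laplacian `-∑ Xⱼ²`):
`p_s(x,t) = ((4π)ⁿ (2π) sⁿ⁺¹)⁻¹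
  ∫ exp(i λ t / s - |x|² |λ| coth|λ| / (4 s)) (|λ| / sinh|λ|)ⁿ dλ`.
(The value of the integrand at the single point `λ = 0` is irrelevant.) -/
def heatKernel (n : ℕ) (s : ℝ) (x : EuclideanSpace ℝ (Fin (2 * n))) (t : ℝ) : ℂ :=
  (1 / ((4 * Real.pi) ^ n * (2 * Real.pi) * s ^ (n + 1)) : ℝ) *
    ∫ l : ℝ,
      Complex.exp (Complex.I * ((l * t / s : ℝ) : ℂ)
          - ((‖x‖ ^ 2 / (4 * s) * (|l| * (Real.cosh |l| / Real.sinh |l|)) : ℝ) : ℂ)) *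
        (((|l| / Real.sinh |l|) ^ n : ℝ) : ℂ)

/-- The heat kernel as a function of the radial variables `R = |x|² / 4` and `r = |t|`. -/
def radialHeatKernel (n : ℕ) (s R r : ℝ) : ℂ :=
  (1 / ((4 * Real.pi) ^ n * (2 * Real.pi) * s ^ (n + 1)) : ℝ) *
    ∫ l : ℝ,
      Complex.exp (Complex.I * ((l * r / s : ℝ) : ℂ)
          - ((R / s * (|l| * (Real.cosh |l| / Real.sinh |l|)) : ℝ) : ℂ)) *
        (((|l| / Real.sinh |l|) ^ n : ℝ) : ℂ)

/-- The heat kernel depends only on `R = |x|² / 4` and `|t|`. -/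
theorem heatKernel_eq_radialHeatKernel (n : ℕ) (s : ℝ) (x : EuclideanSpace ℝ (Fin (2 * n)))
    (t : ℝ) : heatKernel n s x t = radialHeatKernel n s (‖x‖ ^ 2 / 4) |t| := by
  unfold heatKernel radialHeatKernel
  congr 1
  have hR : ‖x‖ ^ 2 / (4 * s) = ‖x‖ ^ 2 / 4 / s := by rw [div_div]
  rw [hR]
  rcases abs_choice t with h | h
  · rw [h]
  · rw [h, ← MeasureTheory.integral_neg_eq_self]
    simp only [abs_neg, neg_mul, mul_neg]

/-- The radial partial derivatives
`p_{s,k₁,k₂}(x,t) = ∂^{k₁}/∂R^{k₁} ∂^{k₂}/∂|t|^{k₂} p_s`, evaluated at `R = |x|² / 4` and `|t|`.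
The radial variables range over `[0,∞)`, and the derivatives are one-sided at the endpoint. -/
def radialDeriv (n : ℕ) (s : ℝ) (k₁ k₂ : ℕ) (x : EuclideanSpace ℝ (Fin (2 * n))) (t : ℝ) : ℂ :=
  iteratedDerivWithin k₁
    (fun R : ℝ => iteratedDerivWithin k₂ (fun r : ℝ => radialHeatKernel n s R r) (Ici 0) |t|)
    (Ici 0) (‖x‖ ^ 2 / 4)

/-- `θ(y) = (2y - sin 2y) / (2 sin² y)` for `y ≠ 0`, and `θ(0) = 0`; it maps `(-π, π)`
bijectively onto `ℝ`. -/
def theta (y : ℝ) : ℝ :=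
  if y = 0 then 0 else (2 * y - Real.sin (2 * y)) / (2 * Real.sin y ^ 2)

/-- `y_ω = θ⁻¹(ω) ∈ (-π, π)`. -/
def yOmega (ω : ℝ) : ℝ := Function.invFunOn theta (Ioo (-Real.pi) Real.pi) ω

/-- The Carnot-Carathéodory distance of `(x,t)` from the origin: `|x| y_ω / sin y_ω` with
`ω = |t| / R`, `R = |x|² / 4`, if `x ≠ 0` and `t ≠ 0`; `|x|` if `t = 0`; `√(4π|t|)` if `x = 0`. -/
def ccDist {n : ℕ} (x : EuclideanSpace ℝ (Fin (2 * n))) (t : ℝ) : ℝ :=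
  if t = 0 then ‖x‖
  else if x = 0 then Real.sqrt (4 * Real.pi * |t|)
  else ‖x‖ * (yOmega (|t| / (‖x‖ ^ 2 / 4)) / Real.sin (yOmega (|t| / (‖x‖ ^ 2 / 4))))

/-- `δ = √(R / (π |t|))`, where `R = |x|² / 4` (meaningful for `t ≠ 0`). -/
def deltaParam {n : ℕ} (x : EuclideanSpace ℝ (Fin (2 * n))) (t : ℝ) : ℝ :=
  Real.sqrt (‖x‖ ^ 2 / 4 / (Real.pi * |t|))

/-- `κ = 2 √(π |t| R)`, where `R = |x|² / 4`. -/
def kappaParam {n : ℕ} (x : EuclideanSpace ℝ (Fin (2 * n))) (t : ℝ) : ℝ :=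
  2 * Real.sqrt (Real.pi * |t| * (‖x‖ ^ 2 / 4))

/-- The modified Bessel function of the first kind, of order `ν ∈ ℕ`, on the real line:
`I_ν(z) = ∑ₖ z^{2k+ν} / (2^{2k+ν} k! Γ(k+ν+1))`. -/
def besselI (ν : ℕ) (z : ℝ) : ℝ :=
  ∑' k : ℕ, z ^ (2 * k + ν) / (2 ^ (2 * k + ν) * (Nat.factorial k : ℝ)
    * Real.Gamma ((k : ℝ) + (ν : ℝ) + 1))

/-- The leading term for `δ → 0⁺` with `κ` bounded and bounded away from `0`. -/
def leadingIII (n k₁ k₂ : ℕ) (x : EuclideanSpace ℝ (Fin (2 * n))) (t : ℝ) : ℝ :=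
  (-1) ^ k₂ * Real.pi ^ (k₁ + k₂) / (4 ^ n * (Real.pi * deltaParam x t) ^ (n + k₁ - 1))
    * Real.exp (-(ccDist x t ^ 2) / 4) * Real.exp (-kappaParam x t)
    * besselI (n + k₁ - 1) (kappaParam x t)

/-- The leading term for `κ → 0⁺` and `|t| → ∞`. -/
def leadingIV (n k₁ k₂ : ℕ) (x : EuclideanSpace ℝ (Fin (2 * n))) (t : ℝ) : ℝ :=
  (-1) ^ k₂ * Real.pi ^ (k₁ + k₂) / (4 ^ n * (Nat.factorial (n + k₁ - 1) : ℝ))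
    * |t| ^ (n + k₁ - 1) * Real.exp (-(ccDist x t ^ 2) / 4)

end Heisenberg

end

/-!
In the variables `R = |x|² / 4`, `r = |t|`, the derivative of the kernel is a constant times
`∫ exp (i r z - R z coth z) (-z coth z)^k₁ (i z)^k₂ (z / sinh z)^n dz`. Moving the line of
integration up to `Im z = 3π/2` costs `O(exp (-3πr/2))`, which is negligible, and crosses the
essential singularity `z = iπ` only. On the circle `z = i(π - w/r)`, `|w| = 1`, the phase is
`-πr + w + πrR/w + O(1/r)`, so by Schläfli's formula the contribution of the singularity is
`r^m exp (-πr)` times the Bessel series in `πrR = κ² / 4`, where `m = n + k₁ - 1`.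

Finally `d² / 4` is the maximum of `r y + R y cot y` over `0 < y < π`. With `y = π - e` this
function is `πr - (r e + πR/e) + O(R)`, whose maximum is `πr - κ + O(R)` by the AM-GM inequality.
Hence `exp (-πr)` is `exp (-d²/4 - κ)` up to a factor `1 + O(1/r)`.
-/

noncomputable section

namespace Heisenberg

open MeasureTheory Filter Topology
open Complex (I)
open scoped Real

section Integrand

/-- The entire function `sinh z / z`. -/
def sinhc : ℂ → ℂ := dslope Complex.sinh 0

/-- The meromorphic function `z coth z`, with the removable singularity at `0` removed. -/
def zcoth (z : ℂ) : ℂ := Complex.cosh z / sinhc z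

theorem mul_sinhc (z : ℂ) : z * sinhc z = Complex.sinh z := by
  simpa [sinhc] using sub_smul_dslope Complex.sinh 0 z

theorem sinhc_zero : sinhc 0 = 1 := by
  simp [sinhc, dslope_same]

theorem sinhc_of_ne {z : ℂ} (hz : z ≠ 0) : sinhc z = Complex.sinh z / z := by
  rw [← mul_sinhc, mul_div_cancel_left₀ _ hz]

theorem inv_sinhc_of_ne {z : ℂ} (hz : z ≠ 0) : (sinhc z)⁻¹ = z / Complex.sinh z := by
  rw [sinhc_of_ne hz, inv_div]

theorem zcoth_of_ne {z : ℂ} (hz : z ≠ 0) : zcoth z = z * (Complex.cosh z / Complex.sinh z) := by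
  rw [zcoth, div_eq_mul_inv, inv_sinhc_of_ne hz, mul_div_left_comm]

theorem differentiable_sinhc : Differentiable ℂ sinhc :=
  differentiableOn_univ.1 <| (Complex.differentiableOn_dslope univ_mem).2
    Complex.differentiable_sinh.differentiableOn

theorem differentiableAt_zcoth {z : ℂ} (hz : sinhc z ≠ 0) : DifferentiableAt ℂ zcoth z :=
  (Complex.differentiable_cosh z).fun_div (differentiable_sinhc z) hz

theorem exists_eq_int_mul_pi_mul_I_of_sinh_eq_zero {z : ℂ} (hz : Complex.sinh z = 0) :
    ∃ k : ℤ, z = k * π * I := by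
  have hsin : Complex.sin (z * I) = 0 := by rw [Complex.sin_mul_I, hz, zero_mul]
  obtain ⟨k, hk⟩ := Complex.sin_eq_zero_iff.1 hsin
  refine ⟨-k, ?_⟩
  calc z = -(z * I * I) := by rw [mul_assoc, Complex.I_mul_I]; ring
    _ = _ := by rw [hk]; push_cast; ring

theorem sinhc_ne_zero {z : ℂ} (h0 : -π < z.im) (h1 : z.im < 2 * π) (hz : z ≠ π * I) :
    sinhc z ≠ 0 := by
  intro hsinhc
  obtain ⟨k, rfl⟩ := exists_eq_int_mul_pi_mul_I_of_sinh_eq_zero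
    (z := z) (by rw [← mul_sinhc, hsinhc, mul_zero])
  have him : ((k : ℂ) * π * I).im = k * π := by simp
  rw [him] at h0 h1
  have hk0 : (-1 : ℝ) < k := by nlinarith [Real.pi_pos]
  have hk1 : (k : ℝ) < 2 := by nlinarith [Real.pi_pos]
  norm_cast at hk0 hk1
  obtain rfl | rfl : k = 0 ∨ k = 1 := by omega
  · simp [sinhc_zero] at hsinhc
  · simp at hz

theorem sinhc_ofReal_ne_zero (x : ℝ) : sinhc x ≠ 0 := by
  refine sinhc_ne_zero (by simp [Real.pi_pos]) (by simp [Real.pi_pos]) fun h => ?_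
  simpa [Real.pi_ne_zero.symm] using congrArg Complex.im h

theorem zcoth_ofReal {x : ℝ} (hx : x ≠ 0) :
    zcoth x = ((|x| * (Real.cosh |x| / Real.sinh |x|) : ℝ) : ℂ) := by
  rw [zcoth_of_ne (by exact_mod_cast hx)]
  rcases abs_choice x with h | h <;> rw [h] <;> simp [div_neg]

theorem inv_sinhc_ofReal {x : ℝ} (hx : x ≠ 0) :
    (sinhc x)⁻¹ = ((|x| / Real.sinh |x| : ℝ) : ℂ) := by
  rw [inv_sinhc_of_ne (by exact_mod_cast hx)]
  rcases abs_choice x with h | h <;> rw [h] <;> simp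

theorem mul_coth_le {x : ℝ} (hx : 0 < x) : x * (Real.cosh x / Real.sinh x) ≤ 1 + x := by
  have hs : 0 < Real.sinh x := Real.sinh_pos_iff.2 hx
  have hself : x ≤ Real.sinh x := Real.self_le_sinh_iff.2 hx.le
  have hexp : Real.exp (-x) ≤ 1 := by simpa using hx.le
  have hcosh : Real.cosh x = Real.sinh x + Real.exp (-x) := by
    rw [← Real.cosh_sub_sinh]; ring
  rw [← mul_div_assoc, div_le_iff₀ hs, hcosh]
  nlinarith

theorem div_sinh_le {x : ℝ} (hx : 0 < x) :
    x / Real.sinh x ≤ (1 + 2 * x) * Real.exp (-x) := by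
  have hs : 0 < Real.sinh x := Real.sinh_pos_iff.2 hx
  have hcoth := mul_coth_le hx
  rw [← mul_div_assoc, div_le_iff₀ hs] at hcoth
  rw [div_le_iff₀ hs, Real.exp_neg, mul_right_comm, ← div_eq_mul_inv,
    le_div_iff₀ (Real.exp_pos x), ← Real.cosh_add_sinh]
  linarith

theorem norm_cosh_le_of_one_le_norm_sinh {z : ℂ} (hz : 1 ≤ ‖Complex.sinh z‖) :
    ‖Complex.cosh z‖ ≤ 2 * ‖Complex.sinh z‖ := by
  have hsq : ‖Complex.cosh z‖ ^ 2 ≤ ‖Complex.sinh z‖ ^ 2 + 1 := by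
    rw [← norm_pow, Complex.cosh_sq]
    exact (norm_add_le _ _).trans_eq (by rw [norm_pow, norm_one])
  nlinarith

theorem exp_abs_re_le_of_one_le_norm_sinh {z : ℂ} (hz : 1 ≤ ‖Complex.sinh z‖) :
    Real.exp |z.re| ≤ 3 * ‖Complex.sinh z‖ := by
  have hcosh := norm_cosh_le_of_one_le_norm_sinh hz
  rcases abs_choice z.re with h | h <;> rw [h]
  · rw [← Complex.norm_exp, ← Complex.cosh_add_sinh]
    linarith [norm_add_le (Complex.cosh z) (Complex.sinh z)]
  · rw [← Complex.neg_re, ← Complex.norm_exp, ← Complex.cosh_sub_sinh]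
    linarith [norm_sub_le (Complex.cosh z) (Complex.sinh z)]

theorem abs_re_le_norm_sinh (z : ℂ) : |z.re| ≤ ‖Complex.sinh z‖ := by
  have hsinh : Real.sinh |z.re| ≤ ‖Complex.sinh z‖ := by
    have hexp := abs_norm_sub_norm_le (Complex.exp z) (Complex.exp (-z))
    rw [Complex.norm_exp, Complex.norm_exp, Complex.neg_re] at hexp
    rw [Complex.sinh, norm_div, Complex.norm_two, ← Real.abs_sinh, Real.sinh_eq, abs_div, abs_two]
    gcongr
  exact (Real.self_le_sinh_iff.2 (abs_nonneg _)).trans hsinh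

/-- The holomorphic extension to complex frequencies `z` of the integrand of
`∂^k₁/∂R^k₁ ∂^k₂/∂r^k₂ p₁`, up to the normalization of the heat kernel. -/
def integrand (n k₁ k₂ : ℕ) (R r : ℝ) (z : ℂ) : ℂ :=
  Complex.exp (I * r * z - R * zcoth z) * (-zcoth z) ^ k₁ * (I * z) ^ k₂ * (sinhc z)⁻¹ ^ n

variable {n : ℕ} (k₁ k₂ : ℕ) {R : ℝ} (r : ℝ)

theorem differentiableAt_integrand (n : ℕ) (R : ℝ) {z : ℂ} (hz : sinhc z ≠ 0) :
    DifferentiableAt ℂ (integrand n k₁ k₂ R r) z := by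
  have hcoth := differentiableAt_zcoth hz
  have hinv : DifferentiableAt ℂ (fun z => (sinhc z)⁻¹) z := (differentiable_sinhc z).fun_inv hz
  unfold integrand
  fun_prop

theorem continuous_integrand_ofReal (n : ℕ) (R : ℝ) :
    Continuous fun x : ℝ => integrand n k₁ k₂ R r x :=
  continuous_iff_continuousAt.2 fun x =>
    ContinuousAt.comp (f := Complex.ofReal)
      (differentiableAt_integrand k₁ k₂ r n R (sinhc_ofReal_ne_zero x)).continuousAt
      Complex.continuous_ofReal.continuousAt

theorem exists_add_abs_pow_mul_exp_le (a : ℝ) (ha : 1 ≤ a) (M : ℕ) :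
    ∃ C : ℝ, 0 ≤ C ∧ ∀ x : ℝ, (a + |x|) ^ M * Real.exp (-|x| / 2) ≤ C * (1 + x ^ 2)⁻¹ := by
  refine ⟨(M + 2).factorial * 2 ^ (M + 2) * Real.exp (a / 2), by positivity, fun x => ?_⟩
  have hx := abs_nonneg x
  have hfact := Real.pow_div_factorial_le_exp (x := (a + |x|) / 2) (by positivity) (M + 2)
  rw [div_pow, div_div, div_le_iff₀ (by positivity)] at hfact
  have hsq : 1 + x ^ 2 ≤ (a + |x|) ^ 2 := by nlinarith [sq_abs x]
  have hexp : Real.exp ((a + |x|) / 2) * Real.exp (-|x| / 2) = Real.exp (a / 2) := by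
    rw [← Real.exp_add]; ring_nf
  rw [le_mul_inv_iff₀ (by positivity)]
  calc (a + |x|) ^ M * Real.exp (-|x| / 2) * (1 + x ^ 2)
      ≤ (a + |x|) ^ M * Real.exp (-|x| / 2) * (a + |x|) ^ 2 := by gcongr
    _ = (a + |x|) ^ (M + 2) * Real.exp (-|x| / 2) := by ring
    _ ≤ Real.exp ((a + |x|) / 2) * (2 ^ (M + 2) * (M + 2).factorial) * Real.exp (-|x| / 2) := by
        gcongr
    _ = _ := by rw [mul_right_comm, hexp]; ring

theorem exists_norm_integrand_le (hn : 0 < n) : ∃ C : ℝ, 0 ≤ C ∧ ∀ (R r : ℝ) (z : ℂ),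
    ‖z‖ ≤ 5 + |z.re| → ‖zcoth z‖ ≤ 2 * (5 + |z.re|) →
    ‖(sinhc z)⁻¹‖ ≤ 4 * (5 + |z.re|) * Real.exp (-|z.re|) →
    -(R * (zcoth z).re) ≤ (5 + |z.re|) / 4 →
      ‖integrand n k₁ k₂ R r z‖ ≤ Real.exp (-(r * z.im)) * (C * (1 + z.re ^ 2)⁻¹) := by
  obtain ⟨C, hC, hpow⟩ := exists_add_abs_pow_mul_exp_le 5 (by norm_num) (k₁ + k₂ + n)
  refine ⟨2 ^ k₁ * 4 ^ n * Real.exp (5 / 4) * C, by positivity,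
    fun R r z hz hcoth hsinhc hR => ?_⟩
  set x := |z.re|
  have hx0 : 0 ≤ x := abs_nonneg _
  have hre : (I * r * z - R * zcoth z).re = -(r * z.im) + -(R * (zcoth z).re) := by simp; ring
  have hexp_pow : Real.exp (-x) ^ n ≤ Real.exp (-x) :=
    pow_le_of_le_one (by positivity) (by simpa using hx0) hn.ne'
  have hexp : Real.exp ((5 + x) / 4) * Real.exp (-x) ≤ Real.exp (5 / 4) * Real.exp (-x / 2) := by
    rw [← Real.exp_add, ← Real.exp_add]; exact Real.exp_le_exp.2 (by linarith)
  calc ‖integrand n k₁ k₂ R r z‖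
      = Real.exp (-(r * z.im)) * Real.exp (-(R * (zcoth z).re)) * ‖zcoth z‖ ^ k₁ * ‖z‖ ^ k₂ *
          ‖(sinhc z)⁻¹‖ ^ n := by
        simp only [integrand, norm_mul, norm_pow, norm_neg, Complex.norm_exp, Complex.norm_I,
          one_mul, hre, Real.exp_add]
    _ ≤ Real.exp (-(r * z.im)) * Real.exp ((5 + x) / 4) * (2 * (5 + x)) ^ k₁ * (5 + x) ^ k₂ *
          (4 * (5 + x) * Real.exp (-x)) ^ n := by gcongr
    _ ≤ Real.exp (-(r * z.im)) * Real.exp ((5 + x) / 4) * (2 * (5 + x)) ^ k₁ * (5 + x) ^ k₂ *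
          ((4 * (5 + x)) ^ n * Real.exp (-x)) := by rw [mul_pow (4 * (5 + x))]; gcongr
    _ = Real.exp (-(r * z.im)) * (2 ^ k₁ * 4 ^ n * (5 + x) ^ (k₁ + k₂ + n) *
          (Real.exp ((5 + x) / 4) * Real.exp (-x))) := by rw [mul_pow, mul_pow]; ring
    _ ≤ Real.exp (-(r * z.im)) * (2 ^ k₁ * 4 ^ n * (5 + x) ^ (k₁ + k₂ + n) *
          (Real.exp (5 / 4) * Real.exp (-x / 2))) := by gcongr
    _ = Real.exp (-(r * z.im)) * (2 ^ k₁ * 4 ^ n * Real.exp (5 / 4) *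
          ((5 + x) ^ (k₁ + k₂ + n) * Real.exp (-x / 2))) := by ring
    _ ≤ Real.exp (-(r * z.im)) * (2 ^ k₁ * 4 ^ n * Real.exp (5 / 4) *
          (C * (1 + z.re ^ 2)⁻¹)) := by gcongr ?_ * (?_ * ?_); exact hpow z.re
    _ = _ := by ring

theorem exists_norm_integrand_ofReal_le (hn : 0 < n) : ∃ C : ℝ, 0 ≤ C ∧ ∀ R r x : ℝ,
    -(1 / 8) < R → x ≠ 0 → ‖integrand n k₁ k₂ R r x‖ ≤ C * (1 + x ^ 2)⁻¹ := by
  obtain ⟨C, hC, hbound⟩ := exists_norm_integrand_le k₁ k₂ hn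
  refine ⟨C, hC, fun R r x hR hx => ?_⟩
  have hx0 : 0 < |x| := abs_pos.2 hx
  have hsinh : 0 < Real.sinh |x| := Real.sinh_pos_iff.2 hx0
  have hcosh : 0 < Real.cosh |x| := Real.cosh_pos _
  have hcoth_le := mul_coth_le hx0
  have hcoth_nonneg : 0 ≤ |x| * (Real.cosh |x| / Real.sinh |x|) := by positivity
  have h := hbound R r x
  rw [zcoth_ofReal hx, inv_sinhc_ofReal hx] at h
  simp only [Complex.norm_real, Complex.ofReal_re, Complex.ofReal_im, mul_zero, neg_zero,
    Real.exp_zero, one_mul, Real.norm_of_nonneg hcoth_nonneg, Real.norm_eq_abs x,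
    Real.norm_of_nonneg (div_pos hx0 hsinh).le] at h
  refine h (by linarith) (by linarith) ((div_sinh_le hx0).trans ?_) (by nlinarith)
  gcongr
  linarith

theorem exists_norm_integrand_le_of_one_le_norm_sinh (hn : 0 < n) :
    ∃ C : ℝ, 0 ≤ C ∧ ∀ (R r : ℝ) (z : ℂ), |R| ≤ 1 / 8 → ‖z‖ ≤ 5 + |z.re| →
      1 ≤ ‖Complex.sinh z‖ →
      ‖integrand n k₁ k₂ R r z‖ ≤ Real.exp (-(r * z.im)) * (C * (1 + z.re ^ 2)⁻¹) := by
  obtain ⟨C, hC, hbound⟩ := exists_norm_integrand_le k₁ k₂ hn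
  refine ⟨C, hC, fun R r z hR hz hsinh => ?_⟩
  have hsinh_pos : 0 < ‖Complex.sinh z‖ := by linarith
  have hz0 : z ≠ 0 := by rintro rfl; simp at hsinh_pos
  have hcoth : ‖zcoth z‖ ≤ 2 * (5 + |z.re|) := by
    rw [zcoth_of_ne hz0, norm_mul, norm_div, mul_comm 2]
    gcongr
    exact (div_le_iff₀ hsinh_pos).2 (norm_cosh_le_of_one_le_norm_sinh hsinh)
  refine hbound R r z hz hcoth ?_ ?_
  · have hexp := exp_abs_re_le_of_one_le_norm_sinh hsinh
    rw [inv_sinhc_of_ne hz0, norm_div, Real.exp_neg, ← div_eq_mul_inv,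
      div_le_div_iff₀ hsinh_pos (Real.exp_pos _)]
    calc ‖z‖ * Real.exp |z.re| ≤ (5 + |z.re|) * (3 * ‖Complex.sinh z‖) := by gcongr
      _ ≤ 4 * (5 + |z.re|) * ‖Complex.sinh z‖ := by nlinarith [abs_nonneg z.re]
  · calc -(R * (zcoth z).re) ≤ |R| * |(zcoth z).re| := by rw [← abs_mul]; exact neg_le_abs _
      _ ≤ 1 / 8 * (2 * (5 + |z.re|)) := by
        gcongr
        exact (Complex.abs_re_le_norm _).trans hcoth
      _ = _ := by ring

end Integrand

section RadialDerivatives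

theorem ae_ne_zero : ∀ᵐ x : ℝ, x ≠ 0 := by
  simp [ae_iff]

theorem hasDerivAt_integral_of_norm_deriv_le {F F' : ℝ → ℝ → ℂ} {C : ℝ} {s : Set ℝ} {a : ℝ}
    (hs : s ∈ 𝓝 a) (hF : ∀ u, Continuous (F u)) (hF' : Continuous (F' a))
    (hint : Integrable (F a)) (hderiv : ∀ u x, HasDerivAt (F · x) (F' u x) u)
    (hbound : ∀ u ∈ s, ∀ x ≠ 0, ‖F' u x‖ ≤ C * (1 + x ^ 2)⁻¹) :
    HasDerivAt (fun u => ∫ x, F u x) (∫ x, F' a x) a := by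
  refine (hasDerivAt_integral_of_dominated_loc_of_deriv_le hs
    (Eventually.of_forall fun u => (hF u).aestronglyMeasurable) hint hF'.aestronglyMeasurable
    (bound := fun x => C * (1 + x ^ 2)⁻¹) ?_ (integrable_inv_one_add_sq.const_mul C)
    (Eventually.of_forall fun x u _ => hderiv u x)).2
  filter_upwards [ae_ne_zero] with x hx u hu using hbound u hu x hx

section

variable {n : ℕ} (k₁ k₂ : ℕ) {R : ℝ} (r : ℝ)

theorem integrable_integrand_ofReal (hn : 0 < n) (hR : -(1 / 8) < R) :
    Integrable fun x : ℝ => integrand n k₁ k₂ R r x := by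
  obtain ⟨C, -, hbound⟩ := exists_norm_integrand_ofReal_le k₁ k₂ hn
  refine (integrable_inv_one_add_sq.const_mul C).mono'
    (continuous_integrand_ofReal k₁ k₂ r n R).aestronglyMeasurable ?_
  filter_upwards [ae_ne_zero] with x hx using hbound R r x hR hx

theorem hasDerivAt_integrand_right (n : ℕ) (R : ℝ) (z : ℂ) :
    HasDerivAt (fun r : ℝ => integrand n k₁ k₂ R r z) (integrand n k₁ (k₂ + 1) R r z) r := by
  have hexp : HasDerivAt (fun r : ℝ => I * r * z - R * zcoth z) (I * z) r := by
    simpa using (((hasDerivAt_id r).ofReal_comp.const_mul I).mul_const z).sub_const (R * zcoth z)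
  refine (((hexp.cexp.mul_const _).mul_const _).mul_const _).congr_deriv ?_
  rw [integrand, pow_succ]
  ring

theorem hasDerivAt_integrand_left (n : ℕ) (R : ℝ) (z : ℂ) :
    HasDerivAt (fun R : ℝ => integrand n k₁ k₂ R r z) (integrand n (k₁ + 1) k₂ R r z) R := by
  have hexp : HasDerivAt (fun R : ℝ => I * r * z - R * zcoth z) (-zcoth z) R := by
    simpa using ((hasDerivAt_id R).ofReal_comp.mul_const (zcoth z)).const_sub (I * r * z)
  refine (((hexp.cexp.mul_const _).mul_const _).mul_const _).congr_deriv ?_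
  rw [integrand, pow_succ]
  ring

theorem hasDerivAt_integral_integrand_right (hn : 0 < n) (hR : -(1 / 8) < R) :
    HasDerivAt (fun r => ∫ x : ℝ, integrand n k₁ k₂ R r x)
      (∫ x : ℝ, integrand n k₁ (k₂ + 1) R r x) r := by
  obtain ⟨C, -, hbound⟩ := exists_norm_integrand_ofReal_le k₁ (k₂ + 1) hn
  exact hasDerivAt_integral_of_norm_deriv_le univ_mem
    (fun r => continuous_integrand_ofReal k₁ k₂ r n R)
    (continuous_integrand_ofReal k₁ (k₂ + 1) r n R) (integrable_integrand_ofReal k₁ k₂ r hn hR)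
    (fun r x => hasDerivAt_integrand_right k₁ k₂ r n R x) fun r _ x hx => hbound R r x hR hx

theorem hasDerivAt_integral_integrand_left (hn : 0 < n) (hR : -(1 / 8) < R) :
    HasDerivAt (fun R => ∫ x : ℝ, integrand n k₁ k₂ R r x)
      (∫ x : ℝ, integrand n (k₁ + 1) k₂ R r x) R := by
  obtain ⟨C, -, hbound⟩ := exists_norm_integrand_ofReal_le (k₁ + 1) k₂ hn
  exact hasDerivAt_integral_of_norm_deriv_le (Ioi_mem_nhds hR)
    (fun R => continuous_integrand_ofReal k₁ k₂ r n R)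
    (continuous_integrand_ofReal (k₁ + 1) k₂ r n R) (integrable_integrand_ofReal k₁ k₂ r hn hR)
    (fun R x => hasDerivAt_integrand_left k₁ k₂ r n R x) fun R hR x hx => hbound R r x hR hx

end

theorem iteratedDerivWithin_eq_of_hasDerivWithinAt {𝕜 E : Type*} [NontriviallyNormedField 𝕜]
    [NormedAddCommGroup E] [NormedSpace 𝕜 E] {s : Set 𝕜} (hs : UniqueDiffOn 𝕜 s) {G : ℕ → 𝕜 → E}
    (hG : ∀ k, ∀ x ∈ s, HasDerivWithinAt (G k) (G (k + 1) x) s x) (k : ℕ) {x : 𝕜} (hx : x ∈ s) :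
    iteratedDerivWithin k (G 0) s x = G k x := by
  induction k generalizing x with
  | zero => simp
  | succ k ih =>
    rw [iteratedDerivWithin_succ, derivWithin_congr (fun y hy => ih hy) (ih hx)]
    exact (hG k x hx).derivWithin (hs x hx)

theorem radialHeatKernel_one_eq (n : ℕ) (R r : ℝ) :
    radialHeatKernel n 1 R r =
      (1 / ((4 * π) ^ n * (2 * π)) : ℝ) * ∫ x : ℝ, integrand n 0 0 R r x := by
  rw [radialHeatKernel, one_pow, mul_one]
  congr 1
  refine integral_congr_ae ?_
  filter_upwards [ae_ne_zero] with x hx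
  simp only [integrand, zcoth_ofReal hx, inv_sinhc_ofReal hx, div_one, pow_zero, mul_one]
  push_cast
  ring_nf

theorem radialDeriv_one_eq {n : ℕ} (hn : 0 < n) (k₁ k₂ : ℕ)
    (x : EuclideanSpace ℝ (Fin (2 * n))) (t : ℝ) :
    radialDeriv n 1 k₁ k₂ x t =
      (1 / ((4 * π) ^ n * (2 * π)) : ℝ) *
        ∫ y : ℝ, integrand n k₁ k₂ (‖x‖ ^ 2 / 4) |t| y := by
  set c : ℂ := ((1 / ((4 * π) ^ n * (2 * π)) : ℝ) : ℂ)
  have hR : ‖x‖ ^ 2 / 4 ∈ Ici (0 : ℝ) := by rw [mem_Ici]; positivity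
  have hpos : ∀ R ∈ Ici (0 : ℝ), -(1 / 8) < R := fun R hR => by linarith [mem_Ici.1 hR]
  have hright : ∀ R ∈ Ici (0 : ℝ),
      iteratedDerivWithin k₂ (fun r => radialHeatKernel n 1 R r) (Ici 0) |t| =
        c * ∫ y : ℝ, integrand n 0 k₂ R |t| y := by
    intro R hR
    simp only [radialHeatKernel_one_eq]
    exact iteratedDerivWithin_eq_of_hasDerivWithinAt (uniqueDiffOn_Ici 0)
      (G := fun k r => c * ∫ y : ℝ, integrand n 0 k R r y) (fun k r _ =>
        ((hasDerivAt_integral_integrand_right 0 k r hn (hpos R hR)).const_mul c).hasDerivWithinAt)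
      k₂ (mem_Ici.2 (abs_nonneg t))
  rw [radialDeriv, iteratedDerivWithin_congr hright hR]
  exact iteratedDerivWithin_eq_of_hasDerivWithinAt (uniqueDiffOn_Ici 0)
    (G := fun k R => c * ∫ y : ℝ, integrand n k k₂ R |t| y) (fun k R hR =>
      ((hasDerivAt_integral_integrand_left k k₂ |t| hn (hpos R hR)).const_mul c).hasDerivWithinAt)
    k₁ hR

end RadialDerivatives

section Contour

variable {E : Type*} [NormedAddCommGroup E] [NormedSpace ℂ E] {f : ℂ → E}

theorem exists_primitive_of_convex [CompleteSpace E] {V : Set ℂ} (hV : IsOpen V)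
    (hVc : Convex ℝ V) (hf : DifferentiableOn ℂ f V) :
    ∃ F : ℂ → E, ∀ z ∈ V, HasDerivAt F (f z) z :=
  let ⟨F, hF⟩ := hVc.exists_forall_hasDerivWithinAt hf
  ⟨F, fun z hz => (hF z hz).hasDerivAt (hV.mem_nhds hz)⟩

theorem primitive_sub_primitive_eq {V : Set ℂ} {F G : ℂ → E} (hV : IsOpen V) (hVc : Convex ℝ V)
    (hF : ∀ z ∈ V, HasDerivAt F (f z) z) (hG : ∀ z ∈ V, HasDerivAt G (f z) z) {z w : ℂ}
    (hz : z ∈ V) (hw : w ∈ V) : F z - G z = F w - G w := by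
  have hsub : ∀ u ∈ V, HasDerivAt (fun u => F u - G u) 0 u := fun u hu => by
    simpa using (hF u hu).fun_sub (hG u hu)
  exact hV.is_const_of_deriv_eq_zero hVc.isPreconnected
    (fun u hu => (hsub u hu).differentiableAt.differentiableWithinAt)
    (fun u hu => (hsub u hu).deriv) hz hw

theorem integral_smul_comp_eq_sub_of_primitive [CompleteSpace E] {F : ℂ → E} {γ γ' : ℝ → ℂ}
    {a b : ℝ} (hab : a ≤ b) (hγ : ∀ t, HasDerivAt γ (γ' t) t) (hγ' : Continuous γ')
    (hf : ∀ t ∈ Icc a b, ContinuousAt f (γ t))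
    (hF : ∀ t ∈ Icc a b, HasDerivAt F (f (γ t)) (γ t)) :
    ∫ t in a..b, γ' t • f (γ t) = F (γ b) - F (γ a) := by
  refine intervalIntegral.integral_eq_sub_of_hasDerivAt (f := fun t => F (γ t))
    (fun t ht => (hF t (uIcc_of_le hab ▸ ht)).scomp t (hγ t)) ?_
  refine ContinuousOn.intervalIntegrable_of_Icc hab (hγ'.continuousOn.smul fun t ht => ?_)
  exact ((hf t ht).comp (hγ t).continuousAt).continuousWithinAt

theorem circleMap_re (c : ℂ) (ρ θ : ℝ) : (circleMap c ρ θ).re = c.re + ρ * Real.cos θ := by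
  simp [circleMap]

theorem circleMap_im (c : ℂ) (ρ θ : ℝ) : (circleMap c ρ θ).im = c.im + ρ * Real.sin θ := by
  simp [circleMap]

theorem continuous_deriv_circleMap (c : ℂ) (ρ : ℝ) : Continuous (deriv (circleMap c ρ)) := by
  simpa only [funext (deriv_circleMap c ρ)] using (continuous_circleMap 0 ρ).mul_const I

theorem integral_arc_eq_sub [CompleteSpace E] {F : ℂ → E} {c : ℂ} {ρ α β : ℝ} (hαβ : α ≤ β)
    (hf : ∀ θ ∈ Icc α β, ContinuousAt f (circleMap c ρ θ))
    (hF : ∀ θ ∈ Icc α β, HasDerivAt F (f (circleMap c ρ θ)) (circleMap c ρ θ)) :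
    ∫ θ in α..β, deriv (circleMap c ρ) θ • f (circleMap c ρ θ) =
      F (circleMap c ρ β) - F (circleMap c ρ α) :=
  integral_smul_comp_eq_sub_of_primitive hαβ
    (fun θ => (hasDerivAt_circleMap c ρ θ).differentiableAt.hasDerivAt)
    (continuous_deriv_circleMap c ρ) hf hF

theorem circleIntegral_eq_sum_arcs {c : ℂ} {ρ : ℝ} (hf : ContinuousOn f (Metric.sphere c ρ))
    (hρ : 0 ≤ ρ) :
    (∮ z in C(c, ρ), f z) =
      (∫ θ in -(3 * π / 4)..-(π / 4), deriv (circleMap c ρ) θ • f (circleMap c ρ θ)) +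
      (∫ θ in -(π / 4)..π / 4, deriv (circleMap c ρ) θ • f (circleMap c ρ θ)) +
      (∫ θ in π / 4..3 * π / 4, deriv (circleMap c ρ) θ • f (circleMap c ρ θ)) +
      ∫ θ in 3 * π / 4..5 * π / 4, deriv (circleMap c ρ) θ • f (circleMap c ρ θ) := by
  set g : ℝ → E := fun θ => deriv (circleMap c ρ) θ • f (circleMap c ρ θ)
  have hg : Continuous g := (continuous_deriv_circleMap c ρ).smul <|
    hf.comp_continuous (continuous_circleMap c ρ) (circleMap_mem_sphere c hρ)
  have hperiod : Function.Periodic g (2 * π) := fun θ => by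
    simp only [g, deriv_circleMap, periodic_circleMap _ _ θ]
  have hshift : (∮ z in C(c, ρ), f z) = ∫ θ in -(3 * π / 4)..5 * π / 4, g θ := by
    have := hperiod.intervalIntegral_add_eq 0 (-(3 * π / 4))
    rwa [zero_add, show -(3 * π / 4) + 2 * π = 5 * π / 4 by ring] at this
  simp only [hshift, intervalIntegral.integral_add_adjacent_intervals, hg.intervalIntegrable]

/-- Primitives of `f` on the four parts of `U` cut out by the open half-planes to the south, east,
north and west of `p`. They compare contour integrals around an isolated singularity `p` of `f`. -/
structure HalfPlanePrimitives (f : ℂ → E) (U : Set ℂ) (p : ℂ) where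
  south : ℂ → E
  east : ℂ → E
  north : ℂ → E
  west : ℂ → E
  hasDerivAt_south : ∀ z ∈ U, z.im < p.im → HasDerivAt south (f z) z
  hasDerivAt_east : ∀ z ∈ U, p.re < z.re → HasDerivAt east (f z) z
  hasDerivAt_north : ∀ z ∈ U, p.im < z.im → HasDerivAt north (f z) z
  hasDerivAt_west : ∀ z ∈ U, z.re < p.re → HasDerivAt west (f z) z

variable {U : Set ℂ} {p : ℂ}

theorem nonempty_halfPlanePrimitives [CompleteSpace E] (hU : IsOpen U) (hUc : Convex ℝ U)
    (hf : DifferentiableOn ℂ f (U \ {p})) : Nonempty (HalfPlanePrimitives f U p) := by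
  have key {H : Set ℂ} (hH : IsOpen H) (hHc : Convex ℝ H) (hp : p ∉ H) :
      ∃ F : ℂ → E, ∀ z ∈ U, z ∈ H → HasDerivAt F (f z) z := by
    have hsub : U ∩ H ⊆ U \ {p} := fun z hz => ⟨hz.1, fun h => hp (h ▸ hz.2)⟩
    obtain ⟨F, hF⟩ := exists_primitive_of_convex (hU.inter hH) (hUc.inter hHc) (hf.mono hsub)
    exact ⟨F, fun z hzU hzH => hF z ⟨hzU, hzH⟩⟩
  obtain ⟨S, hS⟩ := key (isOpen_lt Complex.continuous_im continuous_const)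
    (convex_halfSpace_im_lt p.im) (lt_irrefl p.im)
  obtain ⟨E', hE⟩ := key (isOpen_lt continuous_const Complex.continuous_re)
    (convex_halfSpace_re_gt p.re) (lt_irrefl p.re)
  obtain ⟨N, hN⟩ := key (isOpen_lt continuous_const Complex.continuous_im)
    (convex_halfSpace_im_gt p.im) (lt_irrefl p.im)
  obtain ⟨W, hW⟩ := key (isOpen_lt Complex.continuous_re continuous_const)
    (convex_halfSpace_re_lt p.re) (lt_irrefl p.re)
  exact ⟨S, E', N, W, hS, hE, hN, hW⟩

namespace HalfPlanePrimitives

variable (P : HalfPlanePrimitives f U p)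

theorem south_sub_east_eq (hU : IsOpen U) (hUc : Convex ℝ U) {z w : ℂ} (hz : z ∈ U) (hw : w ∈ U)
    (hz' : z.im < p.im ∧ p.re < z.re) (hw' : w.im < p.im ∧ p.re < w.re) :
    P.south z - P.east z = P.south w - P.east w :=
  primitive_sub_primitive_eq (V := U ∩ ({z | z.im < p.im} ∩ {z | p.re < z.re}))
    (hU.inter <| (isOpen_lt Complex.continuous_im continuous_const).inter
      (isOpen_lt continuous_const Complex.continuous_re))
    (hUc.inter <| (convex_halfSpace_im_lt _).inter (convex_halfSpace_re_gt _))
    (fun u hu => P.hasDerivAt_south u hu.1 hu.2.1) (fun u hu => P.hasDerivAt_east u hu.1 hu.2.2)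
    ⟨hz, hz'⟩ ⟨hw, hw'⟩

theorem east_sub_north_eq (hU : IsOpen U) (hUc : Convex ℝ U) {z w : ℂ} (hz : z ∈ U) (hw : w ∈ U)
    (hz' : p.im < z.im ∧ p.re < z.re) (hw' : p.im < w.im ∧ p.re < w.re) :
    P.east z - P.north z = P.east w - P.north w :=
  primitive_sub_primitive_eq (V := U ∩ ({z | p.im < z.im} ∩ {z | p.re < z.re}))
    (hU.inter <| (isOpen_lt continuous_const Complex.continuous_im).inter
      (isOpen_lt continuous_const Complex.continuous_re))
    (hUc.inter <| (convex_halfSpace_im_gt _).inter (convex_halfSpace_re_gt _))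
    (fun u hu => P.hasDerivAt_east u hu.1 hu.2.2) (fun u hu => P.hasDerivAt_north u hu.1 hu.2.1)
    ⟨hz, hz'⟩ ⟨hw, hw'⟩

theorem north_sub_west_eq (hU : IsOpen U) (hUc : Convex ℝ U) {z w : ℂ} (hz : z ∈ U) (hw : w ∈ U)
    (hz' : p.im < z.im ∧ z.re < p.re) (hw' : p.im < w.im ∧ w.re < p.re) :
    P.north z - P.west z = P.north w - P.west w :=
  primitive_sub_primitive_eq (V := U ∩ ({z | p.im < z.im} ∩ {z | z.re < p.re}))
    (hU.inter <| (isOpen_lt continuous_const Complex.continuous_im).inter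
      (isOpen_lt Complex.continuous_re continuous_const))
    (hUc.inter <| (convex_halfSpace_im_gt _).inter (convex_halfSpace_re_lt _))
    (fun u hu => P.hasDerivAt_north u hu.1 hu.2.1) (fun u hu => P.hasDerivAt_west u hu.1 hu.2.2)
    ⟨hz, hz'⟩ ⟨hw, hw'⟩

theorem west_sub_south_eq (hU : IsOpen U) (hUc : Convex ℝ U) {z w : ℂ} (hz : z ∈ U) (hw : w ∈ U)
    (hz' : z.im < p.im ∧ z.re < p.re) (hw' : w.im < p.im ∧ w.re < p.re) :
    P.west z - P.south z = P.west w - P.south w :=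
  primitive_sub_primitive_eq (V := U ∩ ({z | z.im < p.im} ∩ {z | z.re < p.re}))
    (hU.inter <| (isOpen_lt Complex.continuous_im continuous_const).inter
      (isOpen_lt Complex.continuous_re continuous_const))
    (hUc.inter <| (convex_halfSpace_im_lt _).inter (convex_halfSpace_re_lt _))
    (fun u hu => P.hasDerivAt_west u hu.1 hu.2.2) (fun u hu => P.hasDerivAt_south u hu.1 hu.2.1)
    ⟨hz, hz'⟩ ⟨hw, hw'⟩

theorem circleIntegral_eq [CompleteSpace E] {ρ : ℝ} (hρ : 0 < ρ)
    (hf : ∀ z ∈ U \ {p}, ContinuousAt f z) (hsphere : Metric.sphere p ρ ⊆ U) :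
    (∮ z in C(p, ρ), f z) =
      (P.south (circleMap p ρ (-(π / 4))) - P.south (circleMap p ρ (-(3 * π / 4)))) +
      (P.east (circleMap p ρ (π / 4)) - P.east (circleMap p ρ (-(π / 4)))) +
      (P.north (circleMap p ρ (3 * π / 4)) - P.north (circleMap p ρ (π / 4))) +
      (P.west (circleMap p ρ (-(3 * π / 4))) - P.west (circleMap p ρ (3 * π / 4))) := by
  have hpi := Real.pi_pos
  have hmem (θ : ℝ) : circleMap p ρ θ ∈ U := hsphere (circleMap_mem_sphere p hρ.le θ)
  have hcont (θ : ℝ) : ContinuousAt f (circleMap p ρ θ) :=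
    hf _ ⟨hmem θ, circleMap_ne_center hρ.ne'⟩
  have hcontOn : ContinuousOn f (Metric.sphere p ρ) := fun z hz =>
    (hf z ⟨hsphere hz, Metric.ne_of_mem_sphere hz hρ.ne'⟩).continuousWithinAt
  have hlast : circleMap p ρ (5 * π / 4) = circleMap p ρ (-(3 * π / 4)) := by
    rw [← periodic_circleMap p ρ (-(3 * π / 4))]; ring_nf
  rw [circleIntegral_eq_sum_arcs hcontOn hρ.le,
    integral_arc_eq_sub (F := P.south) (by linarith) (fun θ _ => hcont θ) fun θ hθ =>
      P.hasDerivAt_south _ (hmem θ) ?_,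
    integral_arc_eq_sub (F := P.east) (by linarith) (fun θ _ => hcont θ) fun θ hθ =>
      P.hasDerivAt_east _ (hmem θ) ?_,
    integral_arc_eq_sub (F := P.north) (by linarith) (fun θ _ => hcont θ) fun θ hθ =>
      P.hasDerivAt_north _ (hmem θ) ?_,
    integral_arc_eq_sub (F := P.west) (by linarith) (fun θ _ => hcont θ) fun θ hθ =>
      P.hasDerivAt_west _ (hmem θ) ?_, hlast]
  · have := Real.cos_neg_of_pi_div_two_lt_of_lt (x := θ) (by linarith [hθ.1]) (by linarith [hθ.2])
    rw [circleMap_re]; nlinarith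
  · have := Real.sin_pos_of_pos_of_lt_pi (x := θ) (by linarith [hθ.1]) (by linarith [hθ.2])
    rw [circleMap_im]; nlinarith
  · have := Real.cos_pos_of_mem_Ioo (x := θ) ⟨by linarith [hθ.1], by linarith [hθ.2]⟩
    rw [circleMap_re]; nlinarith
  · have := Real.sin_neg_of_neg_of_neg_pi_lt (x := θ) (by linarith [hθ.2]) (by linarith [hθ.1])
    rw [circleMap_im]; nlinarith

theorem integral_boundary_rect_eq [CompleteSpace E] {a b : ℂ} (hre : p.re ∈ Ioo a.re b.re)
    (him : p.im ∈ Ioo a.im b.im) (hf : ∀ z ∈ U \ {p}, ContinuousAt f z)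
    (hrect : Icc a.re b.re ×ℂ Icc a.im b.im ⊆ U) :
    (∫ x : ℝ in a.re..b.re, f (x + a.im * I)) - (∫ x : ℝ in a.re..b.re, f (x + b.im * I)) +
        I • (∫ y : ℝ in a.im..b.im, f (b.re + y * I)) -
        I • (∫ y : ℝ in a.im..b.im, f (a.re + y * I)) =
      (P.south (b.re + a.im * I) - P.south (a.re + a.im * I)) +
      (P.east (b.re + b.im * I) - P.east (b.re + a.im * I)) +
      (P.north (a.re + b.im * I) - P.north (b.re + b.im * I)) +
      (P.west (a.re + a.im * I) - P.west (a.re + b.im * I)) := by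
  have hre_le : a.re ≤ b.re := (hre.1.trans hre.2).le
  have him_le : a.im ≤ b.im := (him.1.trans him.2).le
  have hmem {x y : ℝ} (hx : x ∈ Icc a.re b.re) (hy : y ∈ Icc a.im b.im) : (x + y * I : ℂ) ∈ U :=
    hrect (by simpa [Complex.mem_reProdIm] using And.intro hx hy)
  have hhor {F : ℂ → E} {y : ℝ} (hy : y ∈ Icc a.im b.im) (hyp : y ≠ p.im)
      (hF : ∀ x : ℝ, (x + y * I : ℂ) ∈ U → HasDerivAt F (f (x + y * I)) (x + y * I)) :
      ∫ x : ℝ in a.re..b.re, f (x + y * I) = F (b.re + y * I) - F (a.re + y * I) := by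
    have hγ (x : ℝ) : HasDerivAt (fun x : ℝ => (x + y * I : ℂ)) 1 x :=
      Complex.ofRealCLM.hasDerivAt.add_const (y * I)
    simpa using integral_smul_comp_eq_sub_of_primitive hre_le hγ continuous_const
      (fun x hx => hf _ ⟨hmem hx hy, fun h => hyp (by simpa using congrArg Complex.im h)⟩)
      fun x hx => hF x (hmem hx hy)
  have hver {F : ℂ → E} {x : ℝ} (hx : x ∈ Icc a.re b.re) (hxp : x ≠ p.re)
      (hF : ∀ y : ℝ, (x + y * I : ℂ) ∈ U → HasDerivAt F (f (x + y * I)) (x + y * I)) :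
      I • ∫ y : ℝ in a.im..b.im, f (x + y * I) = F (x + b.im * I) - F (x + a.im * I) := by
    have hγ (y : ℝ) : HasDerivAt (fun y : ℝ => (x + y * I : ℂ)) I y := by
      simpa using (Complex.ofRealCLM.hasDerivAt.mul_const I).const_add (x : ℂ)
    simpa using integral_smul_comp_eq_sub_of_primitive him_le hγ continuous_const
      (fun y hy => hf _ ⟨hmem hx hy, fun h => hxp (by simpa using congrArg Complex.re h)⟩)
      fun y hy => hF y (hmem hx hy)
  rw [hhor (left_mem_Icc.2 him_le) him.1.ne fun _ h =>
      P.hasDerivAt_south _ h (by simpa using him.1),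
    hhor (right_mem_Icc.2 him_le) him.2.ne' fun _ h =>
      P.hasDerivAt_north _ h (by simpa using him.2),
    hver (right_mem_Icc.2 hre_le) hre.2.ne' fun _ h =>
      P.hasDerivAt_east _ h (by simpa using hre.2),
    hver (left_mem_Icc.2 hre_le) hre.1.ne fun _ h =>
      P.hasDerivAt_west _ h (by simpa using hre.1)]
  abel

end HalfPlanePrimitives

theorem integral_boundary_rect_eq_circleIntegral [CompleteSpace E] {a b : ℂ} {ρ : ℝ}
    (hU : IsOpen U) (hUc : Convex ℝ U) (hf : DifferentiableOn ℂ f (U \ {p})) (hρ : 0 < ρ)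
    (hre : p.re ∈ Ioo a.re b.re) (him : p.im ∈ Ioo a.im b.im)
    (hsphere : Metric.sphere p ρ ⊆ U) (hrect : Icc a.re b.re ×ℂ Icc a.im b.im ⊆ U) :
    (∫ x : ℝ in a.re..b.re, f (x + a.im * I)) - (∫ x : ℝ in a.re..b.re, f (x + b.im * I)) +
        I • (∫ y : ℝ in a.im..b.im, f (b.re + y * I)) -
        I • (∫ y : ℝ in a.im..b.im, f (a.re + y * I)) =
      ∮ z in C(p, ρ), f z := by
  obtain ⟨P⟩ := nonempty_halfPlanePrimitives hU hUc hf
  have hcont : ∀ z ∈ U \ {p}, ContinuousAt f z := fun z hz =>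
    (hf.differentiableAt ((hU.sdiff isClosed_singleton).mem_nhds hz)).continuousAt
  have hmem {x y : ℝ} (hx : x ∈ Icc a.re b.re) (hy : y ∈ Icc a.im b.im) : (x + y * I : ℂ) ∈ U :=
    hrect (by simpa [Complex.mem_reProdIm] using And.intro hx hy)
  have hleft : a.re ∈ Icc a.re b.re := left_mem_Icc.2 (hre.1.trans hre.2).le
  have hright : b.re ∈ Icc a.re b.re := right_mem_Icc.2 (hre.1.trans hre.2).le
  have hbot : a.im ∈ Icc a.im b.im := left_mem_Icc.2 (him.1.trans him.2).le
  have htop : b.im ∈ Icc a.im b.im := right_mem_Icc.2 (him.1.trans him.2).le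
  have hcirc (θ : ℝ) : circleMap p ρ θ ∈ U := hsphere (circleMap_mem_sphere p hρ.le θ)
  have hsqrt : 0 < ρ * (√2 / 2) := by positivity
  have hthree : 3 * π / 4 = π - π / 4 := by ring
  have hSE := P.south_sub_east_eq hU hUc (hmem hright hbot) (hcirc (-(π / 4)))
    (by simpa using ⟨him.1, hre.2⟩) (by simpa [circleMap_re, circleMap_im] using hsqrt)
  have hNE := P.east_sub_north_eq hU hUc (hmem hright htop) (hcirc (π / 4))
    (by simpa using ⟨him.2, hre.2⟩) (by simpa [circleMap_re, circleMap_im] using hsqrt)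
  have hNW := P.north_sub_west_eq hU hUc (hmem hleft htop) (hcirc (3 * π / 4))
    (by simpa using ⟨him.2, hre.1⟩) (by simpa [circleMap_re, circleMap_im, hthree] using hsqrt)
  have hSW := P.west_sub_south_eq hU hUc (hmem hleft hbot) (hcirc (-(3 * π / 4)))
    (by simpa using ⟨him.1, hre.1⟩) (by simpa [circleMap_re, circleMap_im, hthree] using hsqrt)
  rw [P.integral_boundary_rect_eq hre him hcont hrect, P.circleIntegral_eq hρ hcont hsphere]
  linear_combination (norm := module) hSE + hNE + hNW + hSW

theorem integral_sub_integral_eq_circleIntegral [CompleteSpace E] {a b ρ : ℝ} {B : ℝ → ℝ}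
    (hU : IsOpen U) (hUc : Convex ℝ U) (hf : DifferentiableOn ℂ f (U \ {p})) (hρ : 0 < ρ)
    (him : p.im ∈ Ioo a b) (hsphere : Metric.sphere p ρ ⊆ U) (hstrip : Complex.im ⁻¹' Icc a b ⊆ U)
    (hB : Tendsto B atTop (𝓝 0))
    (hbound : ∀ z : ℂ, z.im ∈ Icc a b → 1 ≤ |z.re| → ‖f z‖ ≤ B |z.re|)
    (ha : Integrable fun x : ℝ => f (x + a * I)) (hb : Integrable fun x : ℝ => f (x + b * I)) :
    (∫ x : ℝ, f (x + a * I)) - ∫ x : ℝ, f (x + b * I) = ∮ z in C(p, ρ), f z := by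
  have hab : a ≤ b := (him.1.trans him.2).le
  have hside {s : ℝ → ℝ} (hs : ∀ L, |s L| = |L|) :
      Tendsto (fun L : ℝ => I • ∫ y : ℝ in a..b, f (s L + y * I)) atTop (𝓝 0) := by
    refine squeeze_zero_norm' ?_ (by simpa using hB.mul_const |b - a|)
    filter_upwards [eventually_ge_atTop 1] with L hL
    have hL' : |s L| = L := (hs L).trans (abs_of_pos (by linarith))
    rw [norm_smul, Complex.norm_I, one_mul]
    refine intervalIntegral.norm_integral_le_of_norm_le_const fun y hy => ?_
    rw [uIoc_of_le hab] at hy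
    simpa [hL'] using
      hbound (s L + y * I) (by simpa using ⟨hy.1.le, hy.2⟩) (by simpa [hL'] using hL)
  have hlim := (((intervalIntegral_tendsto_integral ha tendsto_neg_atTop_atBot tendsto_id).sub
    (intervalIntegral_tendsto_integral hb tendsto_neg_atTop_atBot tendsto_id)).add
    (hside (s := id) fun _ => rfl)).sub (hside (s := Neg.neg) abs_neg)
  rw [add_zero, sub_zero] at hlim
  refine tendsto_nhds_unique_of_eventuallyEq hlim tendsto_const_nhds ?_
  filter_upwards [eventually_gt_atTop |p.re|] with L hL
  rw [abs_lt] at hL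
  simpa using integral_boundary_rect_eq_circleIntegral (a := ⟨-L, a⟩) (b := ⟨L, b⟩) hU hUc hf hρ
    hL him hsphere fun z hz => hstrip hz.2

end Contour

section LineIntegral

variable {n : ℕ} (k₁ k₂ : ℕ) (R r : ℝ)

theorem differentiableOn_integrand (n : ℕ) :
    DifferentiableOn ℂ (integrand n k₁ k₂ R r) (Complex.im ⁻¹' Ioo (-π) (2 * π) \ {π * I}) :=
  fun _ hz => (differentiableAt_integrand k₁ k₂ r n R
    (sinhc_ne_zero hz.1.1 hz.1.2 hz.2)).differentiableWithinAt

theorem continuous_integrand_top (n : ℕ) :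
    Continuous fun x : ℝ => integrand n k₁ k₂ R r (x + (3 * π / 2 : ℝ) * I) := by
  refine (differentiableOn_integrand k₁ k₂ R r n).continuousOn.comp_continuous (by fun_prop)
    fun x => ⟨⟨?_, ?_⟩, fun h => ?_⟩
  · simp only [Complex.add_im, Complex.ofReal_im, Complex.im_ofReal_mul, Complex.I_im]
    linarith [Real.pi_pos]
  · simp only [Complex.add_im, Complex.ofReal_im, Complex.im_ofReal_mul, Complex.I_im]
    linarith [Real.pi_pos]
  · have him := congrArg Complex.im h
    simp only [Complex.add_im, Complex.ofReal_im, Complex.im_ofReal_mul, Complex.I_im] at him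
    linarith [Real.pi_pos]

theorem norm_le_five_add_abs_re {z : ℂ} (hz : z.im ∈ Icc 0 (3 * π / 2)) :
    ‖z‖ ≤ 5 + |z.re| := by
  have hle := Complex.norm_le_abs_re_add_abs_im z
  rw [abs_of_nonneg hz.1] at hle
  linarith [hz.2, Real.pi_lt_d2]

theorem one_le_norm_sinh_top (x : ℝ) : 1 ≤ ‖Complex.sinh (x + (3 * π / 2 : ℝ) * I)‖ := by
  have hsinh : Complex.sinh (x + (3 * π / 2 : ℝ) * I) = -I * (Real.cosh x : ℝ) := by
    have hcos : Real.cos (3 * π / 2) = 0 := by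
      rw [show 3 * π / 2 = π / 2 + π by ring, Real.cos_add_pi, Real.cos_pi_div_two, neg_zero]
    have hsin : Real.sin (3 * π / 2) = -1 := by
      rw [show 3 * π / 2 = π / 2 + π by ring, Real.sin_add_pi, Real.sin_pi_div_two]
    rw [Complex.sinh_add, Complex.sinh_mul_I, Complex.cosh_mul_I, ← Complex.ofReal_sin,
      ← Complex.ofReal_cos, hsin, hcos, Complex.ofReal_cosh]
    push_cast; ring
  rw [hsinh, norm_mul, norm_neg, Complex.norm_I, one_mul, Complex.norm_real]
  exact (Real.one_le_cosh x).trans (le_abs_self _)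

variable {R r}

theorem exists_norm_integrand_strip_le (hn : 0 < n) : ∃ C : ℝ, 0 ≤ C ∧ ∀ (R r : ℝ) (z : ℂ),
    |R| ≤ 1 / 8 → 0 ≤ r → z.im ∈ Icc 0 (3 * π / 2) → 1 ≤ |z.re| →
    ‖integrand n k₁ k₂ R r z‖ ≤ C * (1 + |z.re| ^ 2)⁻¹ := by
  obtain ⟨C, hC, hbound⟩ := exists_norm_integrand_le_of_one_le_norm_sinh k₁ k₂ hn
  refine ⟨C, hC, fun R r z hR hr him hre => ?_⟩
  have h := hbound R r z hR (norm_le_five_add_abs_re him) (hre.trans (abs_re_le_norm_sinh z))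
  have hexp : Real.exp (-(r * z.im)) ≤ 1 :=
    Real.exp_le_one_iff.2 (neg_nonpos.2 (mul_nonneg hr him.1))
  rw [sq_abs]
  exact h.trans (mul_le_of_le_one_left (by positivity) hexp)

theorem exists_norm_integrand_top_le (hn : 0 < n) : ∃ C : ℝ, 0 ≤ C ∧ ∀ R r x : ℝ, |R| ≤ 1 / 8 →
    ‖integrand n k₁ k₂ R r (x + (3 * π / 2 : ℝ) * I)‖ ≤
      C * Real.exp (-(3 * π / 2 * r)) * (1 + x ^ 2)⁻¹ := by
  obtain ⟨C, hC, hbound⟩ := exists_norm_integrand_le_of_one_le_norm_sinh k₁ k₂ hn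
  refine ⟨C, hC, fun R r x hR => ?_⟩
  have him : (x + (3 * π / 2 : ℝ) * I : ℂ).im = 3 * π / 2 := by simp
  have hre : (x + (3 * π / 2 : ℝ) * I : ℂ).re = x := by simp
  have hz := norm_le_five_add_abs_re (z := x + (3 * π / 2 : ℝ) * I)
    (by rw [him]; exact ⟨by positivity, le_rfl⟩)
  have h := hbound R r _ hR hz (one_le_norm_sinh_top x)
  rw [him, hre] at h
  exact h.trans_eq (by ring_nf)

theorem integrable_integrand_top (r : ℝ) (hn : 0 < n) (hR : |R| ≤ 1 / 8) :
    Integrable fun x : ℝ => integrand n k₁ k₂ R r (x + (3 * π / 2 : ℝ) * I) := by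
  obtain ⟨C, -, hbound⟩ := exists_norm_integrand_top_le k₁ k₂ hn
  exact (integrable_inv_one_add_sq.const_mul _).mono'
    (continuous_integrand_top k₁ k₂ R r n).aestronglyMeasurable
    (.of_forall fun x => hbound R r x hR)

theorem integral_integrand_sub_top_eq_circleIntegral (hn : 0 < n) (hR : |R| < 1 / 8) (hr : 0 ≤ r)
    {ρ : ℝ} (hρ : 0 < ρ) (hρπ : ρ < π) :
    (∫ x : ℝ, integrand n k₁ k₂ R r x) -
        ∫ x : ℝ, integrand n k₁ k₂ R r (x + (3 * π / 2 : ℝ) * I) =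
      ∮ z in C(π * I, ρ), integrand n k₁ k₂ R r z := by
  obtain ⟨C, -, hbound⟩ := exists_norm_integrand_strip_le k₁ k₂ hn
  have hpi := Real.pi_pos
  have hdecay : Tendsto (fun L : ℝ => C * (1 + L ^ 2)⁻¹) atTop (𝓝 0) := by
    simpa using ((tendsto_atTop_add_const_left _ 1
      (tendsto_pow_atTop two_ne_zero)).inv_tendsto_atTop).const_mul C
  have him : (π * I : ℂ).im ∈ Ioo 0 (3 * π / 2) := by
    constructor <;> simp only [Complex.im_ofReal_mul, Complex.I_im] <;> linarith
  have hsphere : Metric.sphere (π * I) ρ ⊆ Complex.im ⁻¹' Ioo (-π) (2 * π) := by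
    intro z hz
    have hdist := (Complex.abs_im_le_norm (z - π * I)).trans_eq (mem_sphere_iff_norm.1 hz)
    rw [Complex.sub_im, Complex.im_ofReal_mul, Complex.I_im, mul_one, abs_le] at hdist
    exact ⟨by linarith, by linarith⟩
  have hstrip : Complex.im ⁻¹' Icc 0 (3 * π / 2) ⊆ Complex.im ⁻¹' Ioo (-π) (2 * π) :=
    preimage_mono (Icc_subset_Ioo (by linarith) (by linarith))
  simpa using integral_sub_integral_eq_circleIntegral
    (isOpen_Ioo.preimage Complex.continuous_im) ((convex_Ioo _ _).linear_preimage Complex.imLm)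
    (differentiableOn_integrand k₁ k₂ R r n) hρ him hsphere hstrip hdecay
    (fun z hz hre => hbound R r z hR.le hr hz hre)
    (by simpa using integrable_integrand_ofReal k₁ k₂ r hn (abs_lt.1 hR).1)
    (integrable_integrand_top k₁ k₂ r hn hR.le)

theorem exists_norm_integral_integrand_sub_circleIntegral_le (hn : 0 < n) :
    ∃ C : ℝ, 0 ≤ C ∧ ∀ R r ρ : ℝ, |R| < 1 / 8 → 0 ≤ r → 0 < ρ → ρ < π →
      ‖(∫ x : ℝ, integrand n k₁ k₂ R r x) - ∮ z in C(π * I, ρ), integrand n k₁ k₂ R r z‖ ≤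
        C * Real.exp (-(3 * π / 2 * r)) := by
  obtain ⟨C, hC, hbound⟩ := exists_norm_integrand_top_le k₁ k₂ hn
  refine ⟨C * π, by positivity, fun R r ρ hR hr hρ hρπ => ?_⟩
  rw [← integral_integrand_sub_top_eq_circleIntegral k₁ k₂ hn hR hr hρ hρπ, sub_sub_cancel]
  calc _ ≤ ∫ x : ℝ, C * Real.exp (-(3 * π / 2 * r)) * (1 + x ^ 2)⁻¹ :=
        norm_integral_le_of_norm_le (integrable_inv_one_add_sq.const_mul _)
          (.of_forall fun x => hbound R r x hR.le)
    _ = _ := by rw [integral_const_mul, integral_univ_inv_one_add_sq]; ring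

end LineIntegral

section Schlaefli

theorem circleIntegral_eq_smul_unit {E : Type*} [NormedAddCommGroup E] [NormedSpace ℂ E]
    (f : ℂ → E) (c u : ℂ) :
    (∮ z in C(c, ‖u‖), f z) = u • ∮ w in C(0, 1), f (c + u * w) := by
  set g : ℝ → E := fun θ => deriv (circleMap c ‖u‖) θ • f (circleMap c ‖u‖ θ)
  have hperiod : Function.Periodic g (2 * π) := fun θ => by
    simp only [g, deriv_circleMap, periodic_circleMap _ _ θ]
  have hrotate (θ : ℝ) : circleMap c ‖u‖ (θ + u.arg) = c + u * circleMap 0 1 θ := by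
    conv_rhs => rw [← Complex.norm_mul_exp_arg_mul_I u]
    simp only [circleMap, Complex.ofReal_add, Complex.ofReal_one, add_mul, Complex.exp_add]
    ring
  have hshift : ∫ θ in 0..2 * π, g θ = ∫ θ in 0..2 * π, g (θ + u.arg) := by
    rw [intervalIntegral.integral_comp_add_right, zero_add, add_comm (2 * π)]
    simpa using (hperiod.intervalIntegral_add_eq u.arg 0).symm
  rw [circleIntegral, circleIntegral, ← intervalIntegral.integral_smul, hshift]
  refine intervalIntegral.integral_congr fun θ _ => ?_
  have hderiv : deriv (circleMap c ‖u‖) (θ + u.arg) = u * deriv (circleMap 0 1) θ := by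
    have h := hrotate θ
    simp only [circleMap, add_right_inj, zero_add] at h
    simp only [deriv_circleMap, circleMap, zero_add, h, mul_assoc]
  simp only [g, hrotate, hderiv, mul_smul]

theorem hasSum_circleIntegral_of_norm_le {E : Type*} [NormedAddCommGroup E] [NormedSpace ℂ E]
    {F : ℕ → ℂ → E} {f : ℂ → E} {B : ℕ → ℝ} {c : ℂ} {ρ : ℝ} (hρ : 0 ≤ ρ)
    (hF : ∀ k, ContinuousOn (F k) (Metric.sphere c ρ))
    (hbound : ∀ k, ∀ w ∈ Metric.sphere c ρ, ‖F k w‖ ≤ B k) (hB : Summable B)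
    (hsum : ∀ w ∈ Metric.sphere c ρ, HasSum (fun k => F k w) (f w)) :
    HasSum (fun k => ∮ w in C(c, ρ), F k w) (∮ w in C(c, ρ), f w) := by
  refine intervalIntegral.hasSum_integral_of_dominated_convergence (fun k _ => ρ * B k)
    (fun k => ?_) (fun k => .of_forall fun θ _ => ?_) (.of_forall fun _ _ => hB.mul_left ρ)
    intervalIntegrable_const (.of_forall fun θ _ => ?_)
  · exact ((continuous_deriv_circleMap c ρ).smul <| (hF k).comp_continuous
      (continuous_circleMap c ρ) (circleMap_mem_sphere c hρ)).aestronglyMeasurable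
  · rw [norm_smul, deriv_circleMap, norm_mul, Complex.norm_I, mul_one, norm_circleMap_zero,
      abs_of_nonneg hρ]
    gcongr
    exact hbound k _ (circleMap_mem_sphere c hρ θ)
  · exact (hsum _ (circleMap_mem_sphere c hρ θ)).const_smul _

theorem circleIntegral_inv_pow_mul_exp (m : ℕ) :
    (∮ w in C(0, 1), (w ^ (m + 1))⁻¹ * Complex.exp w) = 2 * π * I / m.factorial := by
  have h := (Complex.differentiable_exp.diffContOnCl).circleIntegral_one_div_sub_center_pow_smul
    (c := 0) one_pos m
  simpa [iteratedDeriv_eq_iterate] using h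

/-- The entire function `∑ aᵏ / (k! (k + m)!)` of `a`, which is the modified Bessel function `I_m`
at `2 √a` with the factor `√a ^ m` taken out. -/
def besselSeries (m : ℕ) (a : ℝ) : ℝ := ∑' k : ℕ, a ^ k / (k.factorial * (k + m).factorial)

theorem pow_div_factorial_mul_le (m k : ℕ) {a : ℝ} (ha : 0 ≤ a) :
    a ^ k / (k.factorial * (k + m).factorial) ≤ (m.factorial : ℝ)⁻¹ * (a ^ k / k.factorial) := by
  have hfact : (m.factorial : ℝ) ≤ (k + m).factorial := by
    exact_mod_cast Nat.factorial_le (Nat.le_add_left m k)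
  rw [inv_mul_eq_div, div_div]
  gcongr

theorem summable_besselSeries (m : ℕ) {a : ℝ} (ha : 0 ≤ a) :
    Summable fun k : ℕ => a ^ k / (k.factorial * (k + m).factorial) :=
  .of_nonneg_of_le (fun _ => by positivity) (fun k => pow_div_factorial_mul_le m k ha)
    ((Real.summable_pow_div_factorial a).mul_left _)

theorem inv_factorial_le_besselSeries (m : ℕ) {a : ℝ} (ha : 0 ≤ a) :
    (m.factorial : ℝ)⁻¹ ≤ besselSeries m a := by
  have := (summable_besselSeries m ha).le_tsum 0 fun k _ => by positivity
  simpa [besselSeries] using this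

theorem besselSeries_le (m : ℕ) {a : ℝ} (ha : 0 ≤ a) :
    besselSeries m a ≤ (m.factorial : ℝ)⁻¹ * Real.exp a := by
  rw [Real.exp_eq_exp_ℝ, NormedSpace.exp_eq_tsum_div, ← tsum_mul_left]
  exact (summable_besselSeries m ha).tsum_le_tsum (fun k => pow_div_factorial_mul_le m k ha)
    ((Real.summable_pow_div_factorial a).mul_left _)

theorem besselI_eq (m : ℕ) (z : ℝ) : besselI m z = (z / 2) ^ m * besselSeries m (z ^ 2 / 4) := by
  rw [besselI, besselSeries, ← tsum_mul_left]
  refine tsum_congr fun k => ?_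
  have hGamma : Real.Gamma ((k : ℝ) + m + 1) = (k + m).factorial := by
    exact_mod_cast Real.Gamma_nat_eq_factorial (k + m)
  rw [hGamma, pow_add, pow_add, pow_mul, pow_mul, div_pow, div_pow]
  norm_num
  field_simp

/-- Schläfli's integral for the modified Bessel function. -/
theorem circleIntegral_inv_pow_mul_exp_add_div (m : ℕ) (a : ℝ) :
    (∮ w in C(0, 1), (w ^ (m + 1))⁻¹ * Complex.exp (w + a / w)) =
      2 * π * I * besselSeries m a := by
  have hne {w : ℂ} (hw : w ∈ Metric.sphere (0 : ℂ) 1) : w ≠ 0 :=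
    Metric.ne_of_mem_sphere hw one_ne_zero
  have hterm (k : ℕ) : (∮ w in C(0, 1),
      (w ^ (m + 1))⁻¹ * Complex.exp w * ((a / w) ^ k / k.factorial)) =
        2 * π * I * (a ^ k / (k.factorial * (k + m).factorial) : ℝ) := by
    have hpow (w : ℂ) : (w ^ (m + 1))⁻¹ * Complex.exp w * ((a / w) ^ k / k.factorial) =
        a ^ k / k.factorial * ((w ^ (k + m + 1))⁻¹ * Complex.exp w) := by
      rw [add_assoc k, pow_add w k, mul_inv, div_pow]; ring
    simp only [hpow, circleIntegral.integral_const_mul, circleIntegral_inv_pow_mul_exp]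
    push_cast
    field_simp
  have hsum := hasSum_circleIntegral_of_norm_le (c := 0) zero_le_one
    (F := fun k w => (w ^ (m + 1))⁻¹ * Complex.exp w * ((a / w) ^ k / k.factorial))
    (f := fun w => (w ^ (m + 1))⁻¹ * Complex.exp (w + a / w))
    (B := fun k => Real.exp 1 * (|a| ^ k / k.factorial)) (fun k w hw => ?_) (fun k w hw => ?_)
    ((Real.summable_pow_div_factorial |a|).mul_left _) fun w hw => ?_
  · simp only [hterm] at hsum
    rw [← hsum.tsum_eq, tsum_mul_left, ← Complex.ofReal_tsum, besselSeries]
  · exact ContinuousAt.continuousWithinAt (by fun_prop (disch := simp [hne hw]))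
  · have hw1 : ‖w‖ = 1 := by simpa using hw
    simp only [norm_mul, norm_inv, norm_div, norm_pow, hw1, one_pow, inv_one, one_mul, div_one,
      Complex.norm_real, Complex.norm_natCast, Real.norm_eq_abs]
    gcongr
    rw [← hw1]
    exact Complex.norm_exp_le_exp_norm w
  · rw [Complex.exp_add, ← mul_assoc]
    refine HasSum.mul_left _ ?_
    rw [Complex.exp_eq_exp_ℂ]
    exact NormedSpace.expSeries_div_hasSum_exp (a / w)

end Schlaefli

section PoleContribution

theorem isBigO_exp_mul_mul_sub {P Q : ℂ → ℂ} (hP : DifferentiableAt ℂ P 0)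
    (hQ : DifferentiableAt ℂ Q 0) (A : ℝ) :
    (fun x : ℂ × ℂ => Complex.exp (x.1 * P x.2) * Q x.2 - Complex.exp (x.1 * P 0) * Q 0)
      =O[𝓟 (Metric.closedBall 0 A) ×ˢ 𝓝 0] fun x => ‖x.2‖ := by
  set l : Filter (ℂ × ℂ) := 𝓟 (Metric.closedBall 0 A) ×ˢ 𝓝 0
  have hs : Tendsto Prod.snd l (𝓝 0) := tendsto_snd
  have hq : ∀ᶠ x in l, ‖x.1‖ ≤ A := by
    filter_upwards [tendsto_fst.eventually (mem_principal_self _)] with x hx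
    simpa using hx
  have hexp0 : (fun x => Complex.exp (x.1 * P 0)) =O[l] fun _ => (1 : ℝ) := by
    refine .of_bound (Real.exp (A * ‖P 0‖)) (hq.mono fun x hx => ?_)
    rw [norm_one, mul_one]
    refine (Complex.norm_exp_le_exp_norm _).trans (Real.exp_le_exp.2 ?_)
    rw [norm_mul]
    gcongr
  have hPs : (fun x => P x.2 - P 0) =O[l] fun x => ‖x.2‖ := by
    simpa [Function.comp_def] using (hP.isBigO_sub.comp_tendsto hs).norm_right
  have hQs : (fun x => Q x.2 - Q 0) =O[l] fun x => ‖x.2‖ := by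
    simpa [Function.comp_def] using (hQ.isBigO_sub.comp_tendsto hs).norm_right
  have hQ1 : (fun x => Q x.2) =O[l] fun _ => (1 : ℝ) :=
    (hQ.continuousAt.tendsto.comp hs).isBigO_one ℝ
  have hphase : (fun x => x.1 * (P x.2 - P 0)) =O[l] fun x => ‖x.2‖ := by
    simpa using (Asymptotics.IsBigO.of_bound A (by simpa using hq)).mul hPs
      (f₁ := Prod.fst) (g₁ := fun _ => (1 : ℝ))
  have hexp : (fun x => Complex.exp (x.1 * (P x.2 - P 0)) - 1) =O[l] fun x => ‖x.2‖ := by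
    have h := (Complex.hasDerivAt_exp 0).isBigO_sub.comp_tendsto
      (hphase.trans_tendsto (by simpa using hs.norm))
    simp only [Function.comp_def, Complex.exp_zero, sub_zero] at h
    exact h.trans hphase
  have hsum := hexp0.mul ((hexp.mul hQ1).add (hQs.congr_right (by simp)))
  refine (hsum.congr_left fun x => ?_).congr_right (by simp)
  rw [mul_sub, Complex.exp_sub]
  field_simp [Complex.exp_ne_zero]
  ring

theorem exists_norm_exp_mul_mul_sub_le {P Q : ℂ → ℂ} (hP : DifferentiableAt ℂ P 0)
    (hQ : DifferentiableAt ℂ Q 0) (A : ℝ) :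
    ∃ C δ : ℝ, 0 ≤ C ∧ 0 < δ ∧ ∀ q s : ℂ, ‖q‖ ≤ A → ‖s‖ < δ →
      ‖Complex.exp (q * P s) * Q s - Complex.exp (q * P 0) * Q 0‖ ≤ C * ‖s‖ := by
  obtain ⟨C, hC, h⟩ := (isBigO_exp_mul_mul_sub hP hQ A).exists_nonneg
  obtain ⟨V, hV, hmem⟩ := ((hasBasis_principal _).prod Metric.nhds_basis_ball).eventually_iff.1
    h.bound
  refine ⟨C, V.2, hC, hV.2, fun q s hq hs => ?_⟩
  simpa using hmem (x := (q, s)) ⟨by simpa using hq, by simpa using hs⟩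

/-- The phase `(π - s) s cot s`, holomorphic at `s = 0`: the exponent `-R z coth z` of the
integrand equals `R * polePhase s / s` at the point `z = i(π - s)` near the pole `iπ`. -/
def polePhase (s : ℂ) : ℂ := (π - s) * Complex.cos s / sinhc (s * I)

/-- The factor of the integrand at `z = i(π - s)` that is holomorphic at `s = 0`, once the
exponential and the pole `s ^ (-(k₁ + n))` are taken out. -/
def poleAmplitude (n k₁ k₂ : ℕ) (s : ℂ) : ℂ :=
  polePhase s ^ k₁ * (s - π) ^ k₂ * ((π - s) / sinhc (s * I)) ^ n

theorem polePhase_zero : polePhase 0 = π := by simp [polePhase, sinhc_zero]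

theorem poleAmplitude_zero (n k₁ k₂ : ℕ) :
    poleAmplitude n k₁ k₂ 0 = ((-1) ^ k₂ * π ^ (k₁ + k₂ + n) : ℝ) := by
  simp only [poleAmplitude, polePhase_zero, zero_mul, sinhc_zero, zero_sub, sub_zero, div_one,
    neg_pow (π : ℂ)]
  push_cast
  ring

theorem sinhc_mul_I_ne_zero {s : ℂ} (hs : ‖s‖ < π) : sinhc (s * I) ≠ 0 := by
  obtain ⟨hlower, hupper⟩ := abs_lt.1 ((Complex.abs_re_le_norm s).trans_lt hs)
  refine sinhc_ne_zero (by simpa using hlower) (by simpa using by linarith [Real.pi_pos])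
    fun h => hs.ne ?_
  rw [mul_right_cancel₀ Complex.I_ne_zero h, Complex.norm_of_nonneg Real.pi_pos.le]

theorem differentiableAt_sinhc_mul_I (s : ℂ) : DifferentiableAt ℂ (fun s => sinhc (s * I)) s :=
  (differentiable_sinhc _).comp s (by fun_prop)

theorem differentiableAt_polePhase {s : ℂ} (hs : ‖s‖ < π) : DifferentiableAt ℂ polePhase s :=
  DifferentiableAt.fun_div (by fun_prop) (differentiableAt_sinhc_mul_I s) (sinhc_mul_I_ne_zero hs)

theorem differentiableAt_poleAmplitude (n k₁ k₂ : ℕ) {s : ℂ} (hs : ‖s‖ < π) :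
    DifferentiableAt ℂ (poleAmplitude n k₁ k₂) s := by
  have hphase := differentiableAt_polePhase hs
  have hquot : DifferentiableAt ℂ (fun s : ℂ => (π - s) / sinhc (s * I)) s :=
    DifferentiableAt.fun_div (by fun_prop) (differentiableAt_sinhc_mul_I s)
      (sinhc_mul_I_ne_zero hs)
  unfold poleAmplitude
  fun_prop

theorem zcoth_pi_sub_mul_I {s : ℂ} (hs : s ≠ 0) (hπ : s ≠ π) :
    zcoth ((π - s) * I) = -(polePhase s / s) := by
  have hz : (π - s) * I ≠ 0 := mul_ne_zero (sub_ne_zero.2 hπ.symm) Complex.I_ne_zero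
  rw [zcoth_of_ne hz, polePhase, sinhc_of_ne (mul_ne_zero hs Complex.I_ne_zero),
    Complex.cosh_mul_I, Complex.sinh_mul_I, Complex.sinh_mul_I, Complex.cos_pi_sub,
    Complex.sin_pi_sub]
  field_simp

theorem inv_sinhc_pi_sub_mul_I {s : ℂ} (hs : s ≠ 0) (hπ : s ≠ π) :
    (sinhc ((π - s) * I))⁻¹ = (π - s) / sinhc (s * I) / s := by
  have hz : (π - s) * I ≠ 0 := mul_ne_zero (sub_ne_zero.2 hπ.symm) Complex.I_ne_zero
  rw [inv_sinhc_of_ne hz, sinhc_of_ne (mul_ne_zero hs Complex.I_ne_zero), Complex.sinh_mul_I,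
    Complex.sinh_mul_I, Complex.sin_pi_sub]
  field_simp

theorem integrand_pi_sub_mul_I (n k₁ k₂ : ℕ) (R r : ℝ) {s : ℂ} (hs : s ≠ 0) (hπ : s ≠ π) :
    integrand n k₁ k₂ R r ((π - s) * I) =
      Complex.exp (-(π * r) + r * s + R / s * polePhase s) * poleAmplitude n k₁ k₂ s /
        s ^ (k₁ + n) := by
  have hexp : I * r * ((π - s) * I) - R * zcoth ((π - s) * I) =
      -(π * r) + r * s + R / s * polePhase s := by
    rw [zcoth_pi_sub_mul_I hs hπ]
    linear_combination (r * (π - s)) * Complex.I_mul_I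
  have hlin : I * ((π - s) * I) = s - π := by
    linear_combination (π - s) * Complex.I_mul_I
  rw [integrand, hexp, hlin, zcoth_pi_sub_mul_I hs hπ, inv_sinhc_pi_sub_mul_I hs hπ,
    poleAmplitude, neg_neg, div_pow _ s, div_pow _ s, pow_add]
  field_simp

/-- The factor `exp ((a / w) * polePhase s) * poleAmplitude s` left over from the integrand at
`z = i(π - s)`, `s = w / r`, `a = r * R`, when `w ^ (-(n + k₁)) * exp w` is taken out. The slow
variable `s` and the fast variable `w` are kept apart because `s → 0` while `‖w‖ = 1`. -/
def poleFactor (n k₁ k₂ : ℕ) (a : ℝ) (s w : ℂ) : ℂ :=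
  Complex.exp (a / w * polePhase s) * poleAmplitude n k₁ k₂ s

theorem circleIntegral_integrand_eq (n k₁ k₂ : ℕ) {m : ℕ} (hm : n + k₁ = m + 1) (R : ℝ) {r : ℝ}
    (hr : 1 ≤ r) :
    (∮ z in C(π * I, r⁻¹), integrand n k₁ k₂ R r z) =
      -I * r ^ m * Complex.exp (-(π * r)) *
        ∮ w in C(0, 1), (w ^ (m + 1))⁻¹ * Complex.exp w *
          poleFactor n k₁ k₂ (r * R) (w / r) w := by
  have hr0 : 0 < r := one_pos.trans_le hr
  have hrC : (r : ℂ) ≠ 0 := by exact_mod_cast hr0.ne'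
  have hnorm : ‖-I / (r : ℂ)‖ = r⁻¹ := by simp [abs_of_pos hr0]
  rw [← hnorm, circleIntegral_eq_smul_unit, smul_eq_mul, ← circleIntegral.integral_const_mul,
    ← circleIntegral.integral_const_mul]
  refine circleIntegral.integral_congr zero_le_one fun w hw => ?_
  have hw0 : w ≠ 0 := Metric.ne_of_mem_sphere hw one_ne_zero
  have hπ : w / r ≠ π := by
    intro h
    have hnorm_eq := congrArg norm h
    rw [norm_div, mem_sphere_zero_iff_norm.1 hw, Complex.norm_real, Complex.norm_real,
      Real.norm_of_nonneg hr0.le, Real.norm_of_nonneg Real.pi_pos.le, one_div] at hnorm_eq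
    linarith [inv_le_one_of_one_le₀ hr, Real.pi_gt_three]
  have hpoint : π * I + -I / r * w = (π - w / r) * I := by ring
  rw [hpoint, integrand_pi_sub_mul_I n k₁ k₂ R r (div_ne_zero hw0 hrC) hπ, Complex.exp_add,
    Complex.exp_add, add_comm k₁, hm, mul_div_cancel₀ _ hrC,
    show (R : ℂ) / (w / r) = (r * R : ℝ) / w by push_cast; field_simp, div_pow w, poleFactor]
  field_simp
  ring

end PoleContribution

section KernelAsymptotics

variable {n m : ℕ} (k₁ k₂ : ℕ)

/-- The leading term of `∂^k₁/∂R^k₁ ∂^k₂/∂r^k₂ p₁` for `r = |t| → ∞` and `r * R` bounded, where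
`n + k₁ = m + 1`. -/
def poleLeading (n k₁ k₂ m : ℕ) (R r : ℝ) : ℝ :=
  (-1) ^ k₂ * π ^ (k₁ + k₂) / 4 ^ n * (r ^ m * Real.exp (-(π * r))) * besselSeries m (π * (r * R))

theorem poleLeading_mul (n : ℕ) (R r : ℝ) :
    (((4 * π) ^ n * (2 * π) * poleLeading n k₁ k₂ m R r : ℝ) : ℂ) =
      -I * r ^ m * Complex.exp (-(π * r)) * ((2 * π * I * besselSeries m (π * (r * R))) *
        ((-1) ^ k₂ * π ^ (k₁ + k₂ + n) : ℝ)) := by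
  simp only [poleLeading]
  push_cast
  rw [mul_pow, pow_add _ (k₁ + k₂)]
  field_simp
  ring_nf
  rw [Complex.I_sq]
  ring

theorem circleIntegrable_inv_pow_mul_exp (m : ℕ) {g : ℂ → ℂ}
    (hg : ContinuousOn g (Metric.sphere 0 1)) :
    CircleIntegrable (fun w => (w ^ (m + 1))⁻¹ * Complex.exp w * g w) 0 1 := by
  refine ContinuousOn.circleIntegrable zero_le_one (ContinuousOn.mul (fun w hw => ?_) hg)
  have hw0 : w ≠ 0 := Metric.ne_of_mem_sphere hw one_ne_zero
  exact ContinuousAt.continuousWithinAt (by fun_prop (disch := simp [hw0]))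

theorem norm_circleIntegral_inv_pow_mul_exp_le (m : ℕ) {g : ℂ → ℂ} {B : ℝ}
    (hg : ∀ w ∈ Metric.sphere (0 : ℂ) 1, ‖g w‖ ≤ B) :
    ‖∮ w in C(0, 1), (w ^ (m + 1))⁻¹ * Complex.exp w * g w‖ ≤ 2 * π * (Real.exp 1 * B) := by
  refine (circleIntegral.norm_integral_le_of_norm_le_const (C := Real.exp 1 * B) zero_le_one
    fun w hw => ?_).trans_eq (by ring)
  have hw1 : ‖w‖ = 1 := mem_sphere_zero_iff_norm.1 hw
  rw [norm_mul, norm_mul, norm_inv, norm_pow, hw1, one_pow, inv_one, one_mul]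
  gcongr
  · exact hw1 ▸ Complex.norm_exp_le_exp_norm w
  · exact hg w hw

theorem norm_circleIntegral_inv_pow_mul_exp_sub_le (m : ℕ) {g g₀ : ℂ → ℂ} {B : ℝ}
    (hg : ContinuousOn g (Metric.sphere 0 1)) (hg₀ : ContinuousOn g₀ (Metric.sphere 0 1))
    (hB : ∀ w ∈ Metric.sphere (0 : ℂ) 1, ‖g w - g₀ w‖ ≤ B) :
    ‖(∮ w in C(0, 1), (w ^ (m + 1))⁻¹ * Complex.exp w * g w) -
        ∮ w in C(0, 1), (w ^ (m + 1))⁻¹ * Complex.exp w * g₀ w‖ ≤ 2 * π * (Real.exp 1 * B) := by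
  rw [← circleIntegral.integral_sub (circleIntegrable_inv_pow_mul_exp m hg)
    (circleIntegrable_inv_pow_mul_exp m hg₀)]
  simpa only [mul_sub] using norm_circleIntegral_inv_pow_mul_exp_le m hB

theorem continuousOn_poleFactor (n : ℕ) (a : ℝ) {s : ℂ → ℂ} (hs : Continuous s)
    (hπ : ∀ w ∈ Metric.sphere (0 : ℂ) 1, ‖s w‖ < π) :
    ContinuousOn (fun w => poleFactor n k₁ k₂ a (s w) w) (Metric.sphere 0 1) := by
  intro w hw
  have hw0 : w ≠ 0 := Metric.ne_of_mem_sphere hw one_ne_zero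
  have hphase : ContinuousAt (fun w => polePhase (s w)) w :=
    (differentiableAt_polePhase (hπ w hw)).continuousAt.comp hs.continuousAt
  have hamplitude : ContinuousAt (fun w => poleAmplitude n k₁ k₂ (s w)) w :=
    (differentiableAt_poleAmplitude n k₁ k₂ (hπ w hw)).continuousAt.comp
      (f := s) hs.continuousAt
  unfold poleFactor
  exact ContinuousAt.continuousWithinAt (by fun_prop (disch := exact hw0))

theorem poleLeading_eq_circleIntegral (n : ℕ) (R r : ℝ) :
    (((4 * π) ^ n * (2 * π) * poleLeading n k₁ k₂ m R r : ℝ) : ℂ) =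
      -I * r ^ m * Complex.exp (-(π * r)) *
        ∮ w in C(0, 1), (w ^ (m + 1))⁻¹ * Complex.exp w * poleFactor n k₁ k₂ (r * R) 0 w := by
  rw [poleLeading_mul, ← circleIntegral_inv_pow_mul_exp_add_div, mul_comm (∮ w in C(0, 1), _),
    ← circleIntegral.integral_const_mul]
  congr 2 with w
  rw [poleFactor, polePhase_zero, poleAmplitude_zero, Complex.exp_add]
  push_cast
  ring_nf

theorem exists_norm_circleIntegral_sub_poleLeading_le (n : ℕ) (hm : n + k₁ = m + 1) (A : ℝ) :
    ∃ C r₀ : ℝ, 0 ≤ C ∧ ∀ R r : ℝ, r₀ ≤ r → 1 ≤ r → |r * R| ≤ A →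
      ‖(∮ z in C(π * I, r⁻¹), integrand n k₁ k₂ R r z) -
          ((4 * π) ^ n * (2 * π) * poleLeading n k₁ k₂ m R r : ℝ)‖ ≤
        C * (r ^ m * Real.exp (-(π * r)) / r) := by
  obtain ⟨C, δ, hC, hδ, hbound⟩ := exists_norm_exp_mul_mul_sub_le
    (differentiableAt_polePhase (norm_zero.trans_lt Real.pi_pos))
    (differentiableAt_poleAmplitude n k₁ k₂ (norm_zero.trans_lt Real.pi_pos)) A
  refine ⟨2 * π * (Real.exp 1 * C), 2 * δ⁻¹, by positivity, fun R r hr hr1 hA => ?_⟩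
  have hr0 : 0 < r := one_pos.trans_le hr1
  have hnorm : ∀ w ∈ Metric.sphere (0 : ℂ) 1, ‖w / r‖ = r⁻¹ := fun w hw => by
    rw [norm_div, mem_sphere_zero_iff_norm.1 hw, Complex.norm_of_nonneg hr0.le, one_div]
  have hπ : r⁻¹ < π := by linarith [inv_le_one_of_one_le₀ hr1, Real.pi_gt_three]
  have hδr : r⁻¹ < δ := inv_lt_of_inv_lt₀ hδ (by linarith [inv_pos.2 hδ])
  have hdiff : ∀ w ∈ Metric.sphere (0 : ℂ) 1,
      ‖poleFactor n k₁ k₂ (r * R) (w / r) w - poleFactor n k₁ k₂ (r * R) 0 w‖ ≤ C * r⁻¹ :=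
    fun w hw => by
      have hq : ‖((r * R : ℝ) : ℂ) / w‖ ≤ A := by
        rwa [norm_div, mem_sphere_zero_iff_norm.1 hw, div_one, Complex.norm_real]
      have hsub := hbound _ _ hq ((hnorm w hw).trans_lt hδr)
      rwa [hnorm w hw] at hsub
  have hsub := norm_circleIntegral_inv_pow_mul_exp_sub_le m
    (continuousOn_poleFactor k₁ k₂ n (r * R) (by fun_prop) fun w hw => (hnorm w hw).trans_lt hπ)
    (continuousOn_poleFactor k₁ k₂ n (r * R) continuous_const
      fun _ _ => norm_zero.trans_lt Real.pi_pos) hdiff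
  rw [circleIntegral_integrand_eq n k₁ k₂ hm R hr1, poleLeading_eq_circleIntegral, ← mul_sub,
    norm_mul, norm_mul, norm_mul, norm_neg, Complex.norm_I, one_mul, norm_pow,
    Complex.norm_of_nonneg hr0.le, Complex.norm_exp]
  refine (mul_le_mul_of_nonneg_left hsub (by positivity)).trans_eq ?_
  rw [← Complex.ofReal_mul, ← Complex.ofReal_neg, Complex.ofReal_re]
  ring

theorem exp_neg_three_pi_div_two_mul_le (m : ℕ) {r : ℝ} (hr : 1 ≤ r) :
    Real.exp (-(3 * π / 2 * r)) ≤ r ^ m * Real.exp (-(π * r)) / r := by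
  have hr0 : 0 < r := one_pos.trans_le hr
  rw [le_div_iff₀ hr0]
  have hexp : r ≤ Real.exp (π / 2 * r) :=
    calc r ≤ r + 1 := by linarith
      _ ≤ Real.exp r := Real.add_one_le_exp r
      _ ≤ Real.exp (π / 2 * r) := Real.exp_le_exp.2 (by nlinarith [Real.pi_gt_three])
  calc Real.exp (-(3 * π / 2 * r)) * r
      ≤ Real.exp (-(3 * π / 2 * r)) * Real.exp (π / 2 * r) := by gcongr
    _ = 1 * Real.exp (-(π * r)) := by rw [← Real.exp_add, one_mul]; ring_nf
    _ ≤ r ^ m * Real.exp (-(π * r)) := by gcongr; exact one_le_pow₀ hr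

theorem exists_norm_integral_sub_poleLeading_le (hn : 0 < n) (hm : n + k₁ = m + 1) (A : ℝ) :
    ∃ C r₀ : ℝ, 0 ≤ C ∧ ∀ R r : ℝ, r₀ ≤ r → 1 ≤ r → |r * R| ≤ A →
      ‖(∫ y : ℝ, integrand n k₁ k₂ R r y) -
          ((4 * π) ^ n * (2 * π) * poleLeading n k₁ k₂ m R r : ℝ)‖ ≤
        C * (r ^ m * Real.exp (-(π * r)) / r) := by
  obtain ⟨C, hC, hshift⟩ := exists_norm_integral_integrand_sub_circleIntegral_le k₁ k₂ hn
  obtain ⟨C', r₀, hC', hcircle⟩ := exists_norm_circleIntegral_sub_poleLeading_le k₁ k₂ n hm A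
  refine ⟨C + C', max r₀ (8 * A + 1), by positivity, fun R r hr hr1 hA => ?_⟩
  have hr0 : 0 < r := one_pos.trans_le hr1
  have hR : |R| < 1 / 8 := by
    rw [abs_mul, abs_of_pos hr0] at hA
    nlinarith [le_of_max_le_right hr]
  have hρ : r⁻¹ < π := by linarith [inv_le_one_of_one_le₀ hr1, Real.pi_gt_three]
  rw [add_mul]
  refine (norm_sub_le_norm_sub_add_norm_sub _ (∮ z in C(π * I, r⁻¹), integrand n k₁ k₂ R r z)
    _).trans (add_le_add ?_ (hcircle R r (le_of_max_le_left hr) hr1 hA))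
  exact (hshift R r r⁻¹ hR hr0.le (inv_pos.2 hr0) hρ).trans
    (mul_le_mul_of_nonneg_left (exp_neg_three_pi_div_two_mul_le m hr1) hC)

theorem le_abs_poleLeading (n : ℕ) {R r : ℝ} (hR : 0 ≤ R) (hr : 0 ≤ r) :
    π ^ (k₁ + k₂) / 4 ^ n * (m.factorial : ℝ)⁻¹ * (r ^ m * Real.exp (-(π * r))) ≤
      |poleLeading n k₁ k₂ m R r| := by
  have hseries : (m.factorial : ℝ)⁻¹ ≤ besselSeries m (π * (r * R)) :=
    inv_factorial_le_besselSeries m (by positivity)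
  have hseries0 : 0 ≤ besselSeries m (π * (r * R)) := le_trans (by positivity) hseries
  rw [poleLeading, abs_mul, abs_mul, abs_div, abs_mul, abs_pow, abs_neg, abs_one, one_pow,
    one_mul, abs_of_nonneg hseries0, abs_of_nonneg (by positivity : 0 ≤ π ^ (k₁ + k₂)),
    abs_of_nonneg (by positivity : (0 : ℝ) ≤ 4 ^ n),
    abs_of_nonneg (by positivity : 0 ≤ r ^ m * Real.exp (-(π * r))), mul_right_comm]
  gcongr

theorem exists_eq_mul_one_add {z a : ℂ} {η : ℝ} (ha : a ≠ 0) (h : ‖z - a‖ ≤ η * ‖a‖) :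
    ∃ ε : ℂ, ‖ε‖ ≤ η ∧ z = a * (1 + ε) := by
  refine ⟨(z - a) / a, ?_, by field_simp; ring⟩
  rwa [norm_div, div_le_iff₀ (norm_pos_iff.2 ha)]

theorem exists_radialDeriv_eq_poleLeading (hn : 0 < n) (hm : n + k₁ = m + 1) (A : ℝ) :
    ∃ K T : ℝ, 0 ≤ K ∧ 1 ≤ T ∧ ∀ (x : EuclideanSpace ℝ (Fin (2 * n))) (t : ℝ), T ≤ |t| →
      |t| * (‖x‖ ^ 2 / 4) ≤ A → ∃ ε : ℂ, ‖ε‖ ≤ K / |t| ∧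
        radialDeriv n 1 k₁ k₂ x t = poleLeading n k₁ k₂ m (‖x‖ ^ 2 / 4) |t| * (1 + ε) := by
  obtain ⟨C, r₀, hC, hbound⟩ := exists_norm_integral_sub_poleLeading_le k₁ k₂ hn hm A
  set c : ℝ := (4 * π) ^ n * (2 * π)
  set b : ℝ := π ^ (k₁ + k₂) / 4 ^ n * (m.factorial : ℝ)⁻¹
  have hc : 0 < c := by positivity
  have hb : 0 < b := by positivity
  refine ⟨C / (c * b), max r₀ 1, by positivity, le_max_right _ _, fun x t ht hA => ?_⟩
  have ht1 : 1 ≤ |t| := le_of_max_le_right ht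
  have ht0 : 0 < |t| := one_pos.trans_le ht1
  set R := ‖x‖ ^ 2 / 4
  have hR : 0 ≤ R := by positivity
  have hlower := le_abs_poleLeading (m := m) k₁ k₂ n hR ht0.le
  have hne : ((poleLeading n k₁ k₂ m R |t| : ℝ) : ℂ) ≠ 0 := by
    rw [Complex.ofReal_ne_zero, ← abs_pos]
    exact lt_of_lt_of_le (by positivity) hlower
  refine exists_eq_mul_one_add hne ?_
  have hscale : radialDeriv n 1 k₁ k₂ x t - (poleLeading n k₁ k₂ m R |t| : ℝ) =
      (c⁻¹ : ℝ) * ((∫ y : ℝ, integrand n k₁ k₂ R |t| y) -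
        (c * poleLeading n k₁ k₂ m R |t| : ℝ)) := by
    rw [radialDeriv_one_eq hn, mul_sub, ← Complex.ofReal_mul, inv_mul_cancel_left₀ hc.ne', one_div]
  have hsub := hbound R |t| (le_of_max_le_left ht) ht1 (by rwa [abs_of_nonneg (by positivity)])
  rw [hscale, norm_mul, Complex.norm_of_nonneg (by positivity), Complex.norm_real]
  calc c⁻¹ * ‖(∫ y : ℝ, integrand n k₁ k₂ R |t| y) - (c * poleLeading n k₁ k₂ m R |t| : ℝ)‖
      ≤ c⁻¹ * (C * (|t| ^ m * Real.exp (-(π * |t|)) / |t|)) := by gcongr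
    _ = C / (c * b) / |t| * (b * (|t| ^ m * Real.exp (-(π * |t|)))) := by field_simp
    _ ≤ C / (c * b) / |t| * ‖poleLeading n k₁ k₂ m R |t|‖ := by
      rw [Real.norm_eq_abs]; gcongr

end KernelAsymptotics

section Distance

theorem mul_cos_le_sin {y : ℝ} (h0 : 0 ≤ y) (hπ : y ≤ π) : y * Real.cos y ≤ Real.sin y := by
  rcases lt_or_ge y (π / 2) with h | h
  · have hcos : 0 < Real.cos y := Real.cos_pos_of_mem_Ioo ⟨by linarith [Real.pi_pos], h⟩
    simpa only [Real.tan_eq_sin_div_cos, le_div_iff₀ hcos] using Real.le_tan h0 h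
  · exact (mul_nonpos_of_nonneg_of_nonpos h0
      (Real.cos_nonpos_of_pi_div_two_le_of_le h (by linarith))).trans
      (Real.sin_nonneg_of_nonneg_of_le_pi h0 hπ)

/-- The function `r y + R y cot y` of `y ∈ (0, π)`. It is concave, its critical point is
`y = θ⁻¹(r / R)`, and its maximum is a quarter of the squared distance `d(x, t)²` for
`R = |x|² / 4` and `r = |t|`. -/
def distPhase (R r y : ℝ) : ℝ := r * y + R * (y * Real.cos y / Real.sin y)

theorem hasDerivAt_distPhase (R r : ℝ) {y : ℝ} (hy : Real.sin y ≠ 0) :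
    HasDerivAt (distPhase R r)
      (r - R * ((y - Real.sin y * Real.cos y) / Real.sin y ^ 2)) y := by
  have h := ((hasDerivAt_id y).const_mul r).add
    ((((hasDerivAt_id y).mul (Real.hasDerivAt_cos y)).div (Real.hasDerivAt_sin y) hy).const_mul R)
  refine h.congr_deriv ?_
  simp only [id_eq, Pi.mul_apply]
  field_simp
  linear_combination (-y * R) * Real.sin_sq_add_cos_sq y

theorem hasDerivAt_sub_sin_mul_cos_div {y : ℝ} (hy : Real.sin y ≠ 0) :
    HasDerivAt (fun y => (y - Real.sin y * Real.cos y) / Real.sin y ^ 2)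
      (2 * (Real.sin y - y * Real.cos y) / Real.sin y ^ 3) y := by
  have h := ((hasDerivAt_id y).sub ((Real.hasDerivAt_sin y).mul (Real.hasDerivAt_cos y))).div
    ((Real.hasDerivAt_sin y).pow 2) (pow_ne_zero 2 hy)
  refine h.congr_deriv ?_
  simp only [id_eq, Pi.mul_apply, Pi.sub_apply, Pi.pow_apply]
  field_simp
  push_cast
  linear_combination Real.sin y ^ 2 * Real.sin_sq_add_cos_sq y

theorem concaveOn_distPhase {R : ℝ} (r : ℝ) (hR : 0 ≤ R) :
    ConcaveOn ℝ (Ioo 0 π) (distPhase R r) := by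
  have hsin : ∀ y ∈ Ioo 0 π, 0 < Real.sin y := fun y hy => Real.sin_pos_of_mem_Ioo hy
  refine concaveOn_of_hasDerivWithinAt2_nonpos (convex_Ioo 0 π)
    (f' := fun y => r - R * ((y - Real.sin y * Real.cos y) / Real.sin y ^ 2))
    (f'' := fun y => -(R * (2 * (Real.sin y - y * Real.cos y) / Real.sin y ^ 3)))
    (fun y hy => (hasDerivAt_distPhase R r (hsin y hy).ne').continuousAt.continuousWithinAt)
    ?_ ?_ ?_
  all_goals rw [interior_Ioo]; intro y hy
  · exact (hasDerivAt_distPhase R r (hsin y hy).ne').hasDerivWithinAt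
  · exact (((hasDerivAt_sub_sin_mul_cos_div (hsin y hy).ne').const_mul R).const_sub
      r).hasDerivWithinAt
  · have := hsin y hy
    have := sub_nonneg.2 (mul_cos_le_sin hy.1.le hy.2.le)
    exact neg_nonpos.2 (by positivity)

theorem theta_of_ne {y : ℝ} (hy : y ≠ 0) :
    theta y = (y - Real.sin y * Real.cos y) / Real.sin y ^ 2 := by
  rw [theta, if_neg hy, Real.sin_two_mul, mul_assoc, ← mul_sub, mul_div_mul_left _ _ two_ne_zero]

theorem isMaxOn_distPhase {R r y : ℝ} (hR : 0 ≤ R) (hy : y ∈ Ioo 0 π) (hr : r = R * theta y) :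
    IsMaxOn (distPhase R r) (Ioo 0 π) y := by
  have hderiv := hasDerivAt_distPhase R r (Real.sin_pos_of_mem_Ioo hy).ne'
  rw [← theta_of_ne hy.1.ne', ← hr, sub_self] at hderiv
  have hmin := (concaveOn_distPhase r hR).neg.isMinOn_of_rightDeriv_eq_zero
    (by rwa [interior_Ioo])
    ((neg_zero (G := ℝ) ▸ hderiv.neg.hasDerivWithinAt).derivWithin (uniqueDiffWithinAt_Ioi y))
  exact fun z hz => by simpa using hmin hz

theorem distPhase_eq_of_theta {R r y : ℝ} (hy : y ∈ Ioo 0 π) (hr : r = R * theta y) :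
    distPhase R r y = R * (y / Real.sin y) ^ 2 := by
  have := Real.sin_pos_of_mem_Ioo hy
  rw [distPhase, hr, theta_of_ne hy.1.ne']
  field_simp
  ring

theorem theta_lt_two {y : ℝ} (hy : y ≤ π / 2) : theta y < 2 := by
  rcases lt_trichotomy y 0 with hneg | rfl | hpos
  · have hsin := Real.sin_lt (x := -(2 * y)) (by linarith)
    rw [Real.sin_neg] at hsin
    rw [theta, if_neg hneg.ne]
    exact (div_nonpos_of_nonpos_of_nonneg (by linarith) (by positivity)).trans_lt two_pos
  · simp [theta]
  · have hsin : 0 < Real.sin y := Real.sin_pos_of_pos_of_lt_pi hpos (by linarith [Real.pi_pos])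
    have hcos : 0 ≤ Real.cos y := Real.cos_nonneg_of_mem_Icc ⟨by linarith, hy⟩
    rw [theta_of_ne hpos.ne', div_lt_iff₀ (by positivity)]
    have hmul := mul_cos_le_sin hpos.le (by linarith [Real.pi_pos])
    nlinarith [Real.sin_sq_add_cos_sq y, mul_le_mul_of_nonneg_right hmul hcos, pow_pos hsin 2,
      Real.pi_lt_d2]

theorem le_theta_pi_sub_inv {ω : ℝ} (hω : 2 ≤ ω) : ω ≤ theta (π - ω⁻¹) := by
  have hω0 : 0 < ω := by linarith
  have hinv : ω⁻¹ ≤ 1 / 2 := by rw [inv_le_comm₀ hω0 (by norm_num)]; linarith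
  have hinv0 : 0 < ω⁻¹ := inv_pos.2 hω0
  have hπ := Real.pi_gt_three
  have hsin : 0 < Real.sin ω⁻¹ := Real.sin_pos_of_pos_of_lt_pi hinv0 (by linarith)
  have hcos : 0 ≤ Real.cos ω⁻¹ := Real.cos_nonneg_of_mem_Icc ⟨by linarith, by linarith⟩
  rw [theta_of_ne (by linarith : 0 < π - ω⁻¹).ne', Real.sin_pi_sub, Real.cos_pi_sub,
    le_div_iff₀ (by positivity)]
  calc ω * Real.sin ω⁻¹ ^ 2 ≤ ω * ω⁻¹ ^ 2 := by gcongr; exact Real.sin_le hinv0.le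
    _ = ω⁻¹ := by field_simp
    _ ≤ π - ω⁻¹ - Real.sin ω⁻¹ * -Real.cos ω⁻¹ := by linarith [mul_nonneg hsin.le hcos]

theorem exists_theta_eq {ω : ℝ} (hω : 2 ≤ ω) : ∃ y ∈ Ioo (-π) π, theta y = ω := by
  have hinv0 : 0 < ω⁻¹ := inv_pos.2 (by linarith)
  have hinv : ω⁻¹ ≤ 1 / 2 := by rw [inv_le_comm₀ (by linarith) (by norm_num)]; linarith
  have hπ := Real.pi_gt_three
  have hcont : ContinuousOn theta (Icc (π / 2) (π - ω⁻¹)) := fun y hy => by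
    have hy0 : 0 < y := by linarith [hy.1]
    have hsin : Real.sin y ≠ 0 :=
      (Real.sin_pos_of_pos_of_lt_pi hy0 (by linarith [hy.2])).ne'
    exact ((hasDerivAt_sub_sin_mul_cos_div hsin).continuousAt.congr
      ((eventually_ne_nhds hy0.ne').mono fun z hz => (theta_of_ne hz).symm)).continuousWithinAt
  obtain ⟨y, hy, h⟩ := intermediate_value_Icc (by linarith) hcont
    ⟨(theta_lt_two le_rfl).le.trans hω, le_theta_pi_sub_inv hω⟩
  exact ⟨y, ⟨by linarith [hy.1], by linarith [hy.2]⟩, h⟩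

theorem theta_yOmega {ω : ℝ} (hω : 2 ≤ ω) : theta (yOmega ω) = ω :=
  Function.invFunOn_eq (exists_theta_eq hω)

theorem yOmega_mem_Ioo {ω : ℝ} (hω : 2 ≤ ω) : yOmega ω ∈ Ioo (π / 2) π := by
  refine ⟨?_, (Function.invFunOn_mem (exists_theta_eq hω)).2⟩
  by_contra! h
  exact hω.not_gt (theta_yOmega hω ▸ theta_lt_two h)

theorem distPhase_pi_sub (R r e : ℝ) :
    distPhase R r (π - e) = π * r - (r * e + R * ((π - e) * Real.cos e / Real.sin e)) := by
  rw [distPhase, Real.cos_pi_sub, Real.sin_pi_sub]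
  ring

theorem pi_sub_mul_cos_div_sin_le {e : ℝ} (he : 0 < e) (heπ : e ≤ π / 2) :
    (π - e) * Real.cos e / Real.sin e ≤ π / e := by
  have hπ := Real.pi_pos
  have hsin : 0 < Real.sin e := Real.sin_pos_of_pos_of_lt_pi he (by linarith)
  rw [div_le_div_iff₀ hsin he]
  calc (π - e) * Real.cos e * e = (π - e) * (e * Real.cos e) := by ring
    _ ≤ π * Real.sin e := by
      have hmul := mul_cos_le_sin he.le (by linarith)
      have hcos : 0 ≤ Real.cos e := Real.cos_nonneg_of_mem_Icc ⟨by linarith, heπ⟩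
      gcongr
      linarith

theorem pi_div_sub_six_le {e : ℝ} (he : 0 < e) (heπ : e ≤ π / 2) :
    π / e - 6 ≤ (π - e) * Real.cos e / Real.sin e := by
  have hπ := Real.pi_pos
  have hsin : 0 < Real.sin e := Real.sin_pos_of_pos_of_lt_pi he (by linarith)
  have hjordan : 2 * e ≤ π * Real.sin e := by
    have h := Real.mul_le_sin he.le heπ
    rwa [div_mul_eq_mul_div, div_le_iff₀ hπ, mul_comm (Real.sin e)] at h
  have hsub : Real.sin e - e * Real.cos e ≤ e * (e ^ 2 / 2) := by
    nlinarith [Real.one_sub_sq_div_two_le_cos (x := e), Real.sin_le he.le]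
  rw [div_sub' he.ne', div_le_div_iff₀ he hsin]
  have hquad : 3.8 * e ^ 2 ≤ e * (6 * Real.sin e) := by nlinarith [Real.pi_lt_d2]
  have hcubic : π * (e * (e ^ 2 / 2)) ≤ 2.6 * e ^ 2 := by
    have hsmall : π * e / 2 ≤ 2.6 := by nlinarith [Real.pi_lt_d2]
    nlinarith [sq_nonneg e]
  have hcos : e ^ 2 * Real.cos e ≤ e ^ 2 := mul_le_of_le_one_right (sq_nonneg e) (Real.cos_le_one e)
  linarith [mul_le_mul_of_nonneg_left hsub hπ.le, sq_nonneg e]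

theorem two_mul_sqrt_mul_le {a b : ℝ} (ha : 0 ≤ a) (hb : 0 ≤ b) : 2 * √(a * b) ≤ a + b := by
  rw [← le_div_iff₀' two_pos, Real.sqrt_le_left (by positivity)]
  nlinarith [sq_nonneg (a - b)]

theorem le_distPhase_pi_sub {R r e : ℝ} (hR : 0 ≤ R) (he : 0 < e) (heπ : e ≤ π / 2) :
    π * r - (r * e + R * (π / e)) ≤ distPhase R r (π - e) := by
  rw [distPhase_pi_sub]
  linarith [mul_le_mul_of_nonneg_left (pi_sub_mul_cos_div_sin_le he heπ) hR]

theorem distPhase_pi_sub_le {R r e : ℝ} (hR : 0 ≤ R) (hr : 0 ≤ r) (he : 0 < e)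
    (heπ : e ≤ π / 2) :
    distPhase R r (π - e) ≤ π * r - 2 * √(π * r * R) + 6 * R := by
  have hamgm := two_mul_sqrt_mul_le (mul_nonneg hr he.le)
    (mul_nonneg hR (div_pos Real.pi_pos he).le)
  rw [show r * e * (R * (π / e)) = π * r * R by field_simp] at hamgm
  rw [distPhase_pi_sub]
  linarith [mul_le_mul_of_nonneg_left (pi_div_sub_six_le he heπ) hR]

theorem exists_le_distPhase {R r : ℝ} (hR : 0 < R) (hRr : 2 * R ≤ r) :
    ∃ y ∈ Ioo 0 π, π * r - 2 * √(π * r * R) ≤ distPhase R r y := by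
  have hr : 0 < r := by linarith
  have hπ := Real.pi_pos
  -- `e = √(πR / r)` is the equality case of the AM-GM inequality `κ ≤ r e + R π / e`.
  set q := √(π * r * R)
  have hq : 0 < q := Real.sqrt_pos.2 (by positivity)
  have hq2 : q ^ 2 = π * r * R := Real.sq_sqrt (by positivity)
  have he : q / r ≤ π / 2 := by
    rw [div_le_iff₀ hr]
    refine le_of_sq_le_sq ?_ (by positivity)
    have hRπ : R ≤ π * r / 4 := by nlinarith [Real.pi_gt_three]
    linarith [mul_le_mul_of_nonneg_left hRπ (mul_pos hπ hr).le]
  refine ⟨π - q / r, ⟨by linarith, by linarith [div_pos hq hr]⟩, ?_⟩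
  refine le_of_eq_of_le ?_ (le_distPhase_pi_sub hR.le (div_pos hq hr) he)
  field_simp
  linear_combination -hq2

theorem ccDist_sq_div_four_add_kappaParam_mem_Icc {n : ℕ} (x : EuclideanSpace ℝ (Fin (2 * n)))
    {t : ℝ} (ht : t ≠ 0) (hxt : 2 * (‖x‖ ^ 2 / 4) ≤ |t|) :
    ccDist x t ^ 2 / 4 + kappaParam x t - π * |t| ∈ Icc 0 (6 * (‖x‖ ^ 2 / 4)) := by
  rcases eq_or_ne x 0 with rfl | hx
  · have hdist : ccDist (0 : EuclideanSpace ℝ (Fin (2 * n))) t ^ 2 = 4 * π * |t| := by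
      rw [ccDist, if_neg ht, if_pos rfl, Real.sq_sqrt (by positivity)]
    simp [hdist, kappaParam, mul_assoc]
  · have hR : 0 < ‖x‖ ^ 2 / 4 := by have := norm_pos_iff.2 hx; positivity
    have hω : 2 ≤ |t| / (‖x‖ ^ 2 / 4) := by rwa [le_div_iff₀ hR]
    rw [ccDist, if_neg ht, if_neg hx, kappaParam]
    obtain ⟨hlower, hupper⟩ := yOmega_mem_Ioo hω
    have htheta : |t| = ‖x‖ ^ 2 / 4 * theta (yOmega (|t| / (‖x‖ ^ 2 / 4))) := by
      rw [theta_yOmega hω, mul_div_cancel₀ _ hR.ne']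
    set y := yOmega (|t| / (‖x‖ ^ 2 / 4))
    have hy : y ∈ Ioo 0 π := ⟨by linarith [Real.pi_pos], hupper⟩
    have hdist : (‖x‖ * (y / Real.sin y)) ^ 2 / 4 = distPhase (‖x‖ ^ 2 / 4) |t| y := by
      rw [distPhase_eq_of_theta hy htheta]
      ring
    obtain ⟨z, hz, hle⟩ := exists_le_distPhase hR hxt
    have hmax : distPhase (‖x‖ ^ 2 / 4) |t| z ≤ distPhase (‖x‖ ^ 2 / 4) |t| y :=
      isMaxOn_distPhase hR.le hy htheta hz
    have hge := distPhase_pi_sub_le (e := π - y) hR.le (abs_nonneg t) (by linarith) (by linarith)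
    rw [sub_sub_cancel] at hge
    rw [hdist]
    constructor <;> linarith

end Distance

section LeadingTerms

variable {n : ℕ} (k₁ k₂ : ℕ)

theorem kappaParam_nonneg (x : EuclideanSpace ℝ (Fin (2 * n))) (t : ℝ) : 0 ≤ kappaParam x t := by
  unfold kappaParam
  positivity

theorem kappaParam_sq_div_four (x : EuclideanSpace ℝ (Fin (2 * n))) (t : ℝ) :
    kappaParam x t ^ 2 / 4 = π * (|t| * (‖x‖ ^ 2 / 4)) := by
  rw [kappaParam, mul_pow, Real.sq_sqrt (by positivity)]
  ring

theorem kappaParam_eq (x : EuclideanSpace ℝ (Fin (2 * n))) {t : ℝ} (ht : t ≠ 0) :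
    kappaParam x t = 2 * π * |t| * deltaParam x t := by
  have hr : 0 < |t| := abs_pos.2 ht
  rw [kappaParam, deltaParam,
    show π * |t| * (‖x‖ ^ 2 / 4) = (π * |t|) ^ 2 * (‖x‖ ^ 2 / 4 / (π * |t|)) by
      field_simp,
    Real.sqrt_mul (by positivity), Real.sqrt_sq (by positivity)]
  ring

/-- The common form of the two leading terms, valid whenever `|t| → ∞` and `κ` is bounded. -/
def centreLeading (n k₁ k₂ : ℕ) (x : EuclideanSpace ℝ (Fin (2 * n))) (t : ℝ) : ℝ :=
  (-1) ^ k₂ * π ^ (k₁ + k₂) / 4 ^ n *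
    (|t| ^ (n + k₁ - 1) * Real.exp (-(ccDist x t ^ 2) / 4) * Real.exp (-kappaParam x t)) *
    besselSeries (n + k₁ - 1) (kappaParam x t ^ 2 / 4)

theorem poleLeading_eq_centreLeading_mul (x : EuclideanSpace ℝ (Fin (2 * n))) (t : ℝ) :
    poleLeading n k₁ k₂ (n + k₁ - 1) (‖x‖ ^ 2 / 4) |t| =
      centreLeading n k₁ k₂ x t *
        Real.exp (ccDist x t ^ 2 / 4 + kappaParam x t - π * |t|) := by
  have hexp : Real.exp (-(π * |t|)) =
      Real.exp (-(ccDist x t ^ 2) / 4) * Real.exp (-kappaParam x t) *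
        Real.exp (ccDist x t ^ 2 / 4 + kappaParam x t - π * |t|) := by
    rw [← Real.exp_add, ← Real.exp_add]
    ring_nf
  rw [poleLeading, centreLeading, kappaParam_sq_div_four, hexp]
  ring

theorem centreLeading_eq_leadingIII {x : EuclideanSpace ℝ (Fin (2 * n))} {t : ℝ}
    (hκ : 0 < kappaParam x t) : centreLeading n k₁ k₂ x t = leadingIII n k₁ k₂ x t := by
  have ht : t ≠ 0 := by rintro rfl; simp [kappaParam] at hκ
  have hδ : deltaParam x t ≠ 0 := fun h => by simp [kappaParam_eq x ht, h] at hκ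
  have hπ := Real.pi_pos
  rw [centreLeading, leadingIII, besselI_eq,
    show kappaParam x t / 2 = |t| * (π * deltaParam x t) by rw [kappaParam_eq x ht]; ring,
    mul_pow |t|]
  field_simp

theorem centreLeading_eq_leadingIV_mul (x : EuclideanSpace ℝ (Fin (2 * n))) (t : ℝ) :
    centreLeading n k₁ k₂ x t = leadingIV n k₁ k₂ x t *
      (Real.exp (-kappaParam x t) * ((n + k₁ - 1).factorial *
        besselSeries (n + k₁ - 1) (kappaParam x t ^ 2 / 4))) := by
  rw [centreLeading, leadingIV]
  field_simp

theorem exp_neg_mul_factorial_mul_besselSeries_mem_Icc (m : ℕ) {z : ℝ} (hz : 0 ≤ z)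
    (hz4 : z ≤ 4) :
    Real.exp (-z) * (m.factorial * besselSeries m (z ^ 2 / 4)) ∈ Icc (1 - z) 1 := by
  have hfact : (0 : ℝ) < m.factorial := by exact_mod_cast m.factorial_pos
  have hlower : 1 ≤ m.factorial * besselSeries m (z ^ 2 / 4) :=
    (inv_le_iff_one_le_mul₀' hfact).1 (inv_factorial_le_besselSeries m (by positivity))
  have hupper : m.factorial * besselSeries m (z ^ 2 / 4) ≤ Real.exp z := by
    have h := besselSeries_le m (a := z ^ 2 / 4) (by positivity)
    rw [← div_eq_inv_mul, le_div_iff₀' hfact] at h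
    exact h.trans (Real.exp_le_exp.2 (by nlinarith))
  refine ⟨(Real.one_sub_le_exp_neg z).trans (le_mul_of_one_le_right (Real.exp_pos _).le hlower), ?_⟩
  calc Real.exp (-z) * (m.factorial * besselSeries m (z ^ 2 / 4))
      ≤ Real.exp (-z) * Real.exp z := by gcongr
    _ = 1 := by rw [← Real.exp_add, neg_add_cancel, Real.exp_zero]

theorem exists_mul_mul_one_add_eq (b v : ℝ) (ε : ℂ) :
    ∃ ε' : ℂ, ‖ε'‖ ≤ |v| * ‖ε‖ + |v - 1| ∧ ((b * v : ℝ) : ℂ) * (1 + ε) = b * (1 + ε') := by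
  refine ⟨v * ε + (v - 1 : ℝ), (norm_add_le _ _).trans_eq ?_, by push_cast; ring⟩
  rw [norm_mul, Complex.norm_real, Complex.norm_real, Real.norm_eq_abs, Real.norm_eq_abs]

theorem exists_radialDeriv_eq_centreLeading (hn : 0 < n) (C : ℝ) :
    ∃ K T : ℝ, 0 ≤ K ∧ 1 ≤ T ∧ ∀ (x : EuclideanSpace ℝ (Fin (2 * n))) (t : ℝ), T ≤ |t| →
      kappaParam x t ≤ C → ∃ ε : ℂ, ‖ε‖ ≤ K / |t| ∧
        radialDeriv n 1 k₁ k₂ x t = centreLeading n k₁ k₂ x t * (1 + ε) := by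
  obtain ⟨K, T, hK, hT, h⟩ := exists_radialDeriv_eq_poleLeading k₁ k₂ hn
    (show n + k₁ = n + k₁ - 1 + 1 by omega) (C ^ 2)
  refine ⟨3 * K + 12 * C ^ 2, max T (6 * C ^ 2), by positivity, le_max_of_le_left hT,
    fun x t ht hκ => ?_⟩
  have ht1 : 1 ≤ |t| := hT.trans (le_of_max_le_left ht)
  have hr : 0 < |t| := one_pos.trans_le ht1
  have hRt : |t| * (‖x‖ ^ 2 / 4) ≤ C ^ 2 := by
    have hsq : kappaParam x t ^ 2 ≤ C ^ 2 := by gcongr; exact kappaParam_nonneg x t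
    have h4 := kappaParam_sq_div_four x t
    nlinarith [Real.pi_gt_three, mul_nonneg hr.le (by positivity : 0 ≤ ‖x‖ ^ 2 / 4)]
  have hR : ‖x‖ ^ 2 / 4 ≤ C ^ 2 / |t| := by rwa [le_div_iff₀' hr]
  have hsmall : C ^ 2 / |t| ≤ 1 / 6 := by
    rw [div_le_iff₀ hr]
    linarith [le_of_max_le_right ht]
  obtain ⟨hv0, hv⟩ := ccDist_sq_div_four_add_kappaParam_mem_Icc x (abs_pos.1 hr) (by linarith)
  obtain ⟨ε, hε, heq⟩ := h x t (le_of_max_le_left ht) hRt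
  rw [poleLeading_eq_centreLeading_mul] at heq
  set v := ccDist x t ^ 2 / 4 + kappaParam x t - π * |t|
  obtain ⟨ε', hε', heq'⟩ := exists_mul_mul_one_add_eq (centreLeading n k₁ k₂ x t) (Real.exp v) ε
  have hexp : |Real.exp v - 1| ≤ 12 * (C ^ 2 / |t|) := by
    have hsub := Real.abs_exp_sub_one_le (x := v) (abs_le.2 ⟨by linarith, by linarith⟩)
    rw [abs_of_nonneg hv0] at hsub
    linarith
  have hexp3 : |Real.exp v| ≤ 3 := by
    linarith [abs_sub_abs_le_abs_sub (Real.exp v) 1, abs_one (α := ℝ)]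
  refine ⟨ε', hε'.trans ?_, heq.trans heq'⟩
  calc |Real.exp v| * ‖ε‖ + |Real.exp v - 1| ≤ 3 * (K / |t|) + 12 * (C ^ 2 / |t|) := by gcongr
    _ = (3 * K + 12 * C ^ 2) / |t| := by ring

theorem exists_radialDeriv_eq_leadingIII (hn : 0 < n) {C : ℝ} (hC : 0 < C) :
    ∃ δ₀ : ℝ, 0 < δ₀ ∧ ∃ K : ℝ, ∀ (x : EuclideanSpace ℝ (Fin (2 * n))) (t : ℝ),
      deltaParam x t ≤ δ₀ → 1 / C ≤ kappaParam x t → kappaParam x t ≤ C →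
      ∃ ε : ℂ, ‖ε‖ ≤ K * deltaParam x t ∧
        radialDeriv n 1 k₁ k₂ x t = leadingIII n k₁ k₂ x t * (1 + ε) := by
  obtain ⟨K, T, hK, hT, h⟩ := exists_radialDeriv_eq_centreLeading k₁ k₂ hn C
  have hT0 : 0 < T := one_pos.trans_le hT
  refine ⟨(2 * π * C * T)⁻¹, by positivity, K * (2 * π * C), fun x t hδ hκ hκC => ?_⟩
  have hκ0 : 0 < kappaParam x t := lt_of_lt_of_le (by positivity) hκ
  have ht : t ≠ 0 := by rintro rfl; simp [kappaParam] at hκ0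
  have hr : 0 < |t| := abs_pos.2 ht
  have hinv : |t|⁻¹ ≤ 2 * π * C * deltaParam x t := by
    rw [kappaParam_eq x ht, div_le_iff₀ hC] at hκ
    rw [inv_le_iff_one_le_mul₀' hr]
    linarith
  have htT : T ≤ |t| := by
    refine (inv_le_inv₀ hr hT0).1 (hinv.trans ?_)
    calc 2 * π * C * deltaParam x t ≤ 2 * π * C * (2 * π * C * T)⁻¹ := by gcongr
      _ = T⁻¹ := by field_simp
  obtain ⟨ε, hε, heq⟩ := h x t htT hκC
  refine ⟨ε, hε.trans ?_, by rw [heq, centreLeading_eq_leadingIII k₁ k₂ hκ0]⟩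
  rw [div_eq_mul_inv, mul_assoc K]
  gcongr

theorem exists_radialDeriv_eq_leadingIV (hn : 0 < n) :
    ∃ κ₀ : ℝ, 0 < κ₀ ∧ ∃ T : ℝ, 0 < T ∧ ∃ K : ℝ,
      ∀ (x : EuclideanSpace ℝ (Fin (2 * n))) (t : ℝ), kappaParam x t ≤ κ₀ → T ≤ |t| →
        ∃ ε : ℂ, ‖ε‖ ≤ K * (1 / |t| + kappaParam x t) ∧
          radialDeriv n 1 k₁ k₂ x t = leadingIV n k₁ k₂ x t * (1 + ε) := by
  obtain ⟨K, T, hK, hT, h⟩ := exists_radialDeriv_eq_centreLeading k₁ k₂ hn 1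
  refine ⟨1, one_pos, T, one_pos.trans_le hT, K + 1, fun x t hκ ht => ?_⟩
  have hκ0 := kappaParam_nonneg x t
  obtain ⟨ε, hε, heq⟩ := h x t ht hκ
  obtain ⟨hw, hw1⟩ :=
    exp_neg_mul_factorial_mul_besselSeries_mem_Icc (n + k₁ - 1) hκ0 (by linarith)
  rw [centreLeading_eq_leadingIV_mul] at heq
  set w := Real.exp (-kappaParam x t) * ((n + k₁ - 1).factorial *
    besselSeries (n + k₁ - 1) (kappaParam x t ^ 2 / 4))
  obtain ⟨ε', hε', heq'⟩ := exists_mul_mul_one_add_eq (leadingIV n k₁ k₂ x t) w ε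
  have hw_abs : |w| ≤ 1 := abs_le.2 ⟨by linarith, hw1⟩
  have hw_sub : |w - 1| ≤ kappaParam x t := abs_le.2 ⟨by linarith, by linarith⟩
  refine ⟨ε', hε'.trans ?_, heq.trans heq'⟩
  calc |w| * ‖ε‖ + |w - 1| ≤ 1 * (K / |t|) + kappaParam x t := by gcongr
    _ = K * (1 / |t|) + kappaParam x t := by ring
    _ ≤ (K + 1) * (1 / |t| + kappaParam x t) := by
      have : 0 ≤ 1 / |t| := by positivity
      nlinarith

end LeadingTerms

end Heisenberg

end

/-- Asymptotics of the radial partial derivatives of the time-one heat kernel on the Heisenberg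
group, for `δ → 0⁺` with `κ ∈ [1/C, C]`, and for `κ → 0⁺`, `|t| → ∞`. The `O`-terms are factors
`1 + ε` with `ε` bounded by a constant multiple of `δ`, respectively of `1/|t| + κ`, uniformly in
`(x,t)`. -/
theorem theorem3p12 (n : ℕ) (hn : 0 < n) (k₁ k₂ : ℕ) :
    (∀ C : ℝ, 1 < C → ∃ δ₀ : ℝ, 0 < δ₀ ∧ ∃ K : ℝ,
      ∀ (x : EuclideanSpace ℝ (Fin (2 * n))) (t : ℝ),
        Heisenberg.deltaParam x t ≤ δ₀ →
        1 / C ≤ Heisenberg.kappaParam x t → Heisenberg.kappaParam x t ≤ C →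
        ∃ ε : ℂ, ‖ε‖ ≤ K * Heisenberg.deltaParam x t ∧
          Heisenberg.radialDeriv n 1 k₁ k₂ x t
            = (Heisenberg.leadingIII n k₁ k₂ x t : ℂ) * (1 + ε)) ∧
    (∃ κ₀ : ℝ, 0 < κ₀ ∧ ∃ T : ℝ, 0 < T ∧ ∃ K : ℝ,
      ∀ (x : EuclideanSpace ℝ (Fin (2 * n))) (t : ℝ),
        Heisenberg.kappaParam x t ≤ κ₀ → T ≤ |t| →
        ∃ ε : ℂ, ‖ε‖ ≤ K * (1 / |t| + Heisenberg.kappaParam x t) ∧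
          Heisenberg.radialDeriv n 1 k₁ k₂ x t
            = (Heisenberg.leadingIV n k₁ k₂ x t : ℂ) * (1 + ε)) :=
  ⟨fun _ hC => Heisenberg.exists_radialDeriv_eq_leadingIII k₁ k₂ hn (one_pos.trans hC),
    Heisenberg.exists_radialDeriv_eq_leadingIV k₁ k₂ hn⟩
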